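/- There is an absolute constant $c>0$ with the following property. Let $u_0,u_1:\mathbb R^3\to\mathbb R$ be $C^\infty$ radial functions, regarded also as functions of $r=|x|$, and suppose that for some $r_0>0$ $$(u_0)_r(r_0)+|u_1(r_0)|\ \ge\ \frac1{r_0}.$$ Consider $$u_{tt}-\Delta u=u_t^2-|\nabla u|^2,\qquad u(0)=u_0,\quad u_t(0)=u_1 \qquad (*)$$ on $\mathbb R^{3+1}$. A classical solution of $(*)$ is a $C^2$ function that satisfies $(*)$ pointwise on an open set $D\subseteq\mathbb R^3\times\mathbb R$ which contains $\mathbb R^3\times\{0\}$ and, with each point $(x,t)$, the solid light cone $\{(y,s): s \text{ between } 0 \text{ and } t,\ |y-x|\le|t-s|\}$. Then $(*)$ has a maximal classical solution $u$, on a domain $D$: every classical solution of $(*)$ is defined on a subset of $D$ and coincides with $u$ there. This $u$ is $C^\infty$ on $D$, and it blows up at a time $t_0$ with $0<|t_0|\le r_0$, in the following sense. There are $x_0\in\mathbb R^3$ and $C\in\mathbb R$ (depending on the solution) such that $(x_0,t_0)\notin D$, while $(x_0,t)\in D$ for all $t$ strictly between $0$ and $t_0$, and for all $t$ between $0$ and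 $t_0$ that are sufficiently close to $t_0$ $$\|u(t)\|_{L^\infty(B_t)}\ \ge\ C+\big|\ln|t-t_0|\big|,\qquad \|u(t)\|_{H^{3/2}(B_t)}\ \ge\ c\,\big|\ln|t-t_0|\big|^{1/2},$$ where $B_t=\{x:|x-x_0|\le1,\ (x,t)\in D\}$ is the part of the unit ball around $x_0$ on which $u(t)$ is defined, and $$\|f\|_{H^{3/2}(B)}^2=\int_B|f|^2\,dx+\int_B|\nabla f|^2\,dx+\int_B\int_B\frac{|\nabla f(x)-\nabla f(y)|^2}{|x-y|^4}\,dy\,dx .$$ (Both norms may be infinite.) -/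

import Mathlib

open MeasureTheory Set Filter
open scoped Topology ContDiff ENNReal

/-- Three-dimensional Euclidean space. -/
abbrev E3 : Type := EuclideanSpace ℝ (Fin 3)

/-- `f` depends only on `|x|`. -/
def IsRadial (f : E3 → ℝ) : Prop :=
  ∀ x y : E3, ‖x‖ = ‖y‖ → f x = f y

/-- The function of the radius `r` obtained from a radial function `f`, i.e. `f(r) = f(x)` for
`|x| = r`; its derivative at `r > 0` is the radial derivative `f_r(r)`. -/
noncomputable def radialProfile (f : E3 → ℝ) (r : ℝ) : ℝ :=
  f (EuclideanSpace.single 0 r)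

/-- `D ⊆ ℝ³ × ℝ` contains, with each point `(x, t)`, the whole solid light cone with vertex `(x, t)`
between time `t` and time `0` (backward if `t > 0`, forward if `t < 0`). -/
def LightConeClosed (D : Set (E3 × ℝ)) : Prop :=
  ∀ (x : E3) (t : ℝ), (x, t) ∈ D →
    ∀ (y : E3) (s : ℝ), s ∈ uIcc 0 t → ‖y - x‖ ≤ |t - s| → (y, s) ∈ D

/-- `u` is, on the space-time domain `D`, a classical solution of
`u_tt - Δu = u_t² - |∇u|²`, `u(0) = u₀`, `u_t(0) = u₁`.
The domain is an open neighbourhood of `ℝ³ × {0}` and is determined by the initial data through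
light cones; the values of `u` outside `D` are irrelevant. -/
structure IsClassicalSolution (u₀ u₁ : E3 → ℝ) (D : Set (E3 × ℝ)) (u : E3 → ℝ → ℝ) : Prop where
  isOpen : IsOpen D
  initial_mem : ∀ x : E3, (x, (0 : ℝ)) ∈ D
  lightConeClosed : LightConeClosed D
  contDiffOn : ContDiffOn ℝ 2 (fun p : E3 × ℝ => u p.1 p.2) D
  equation : ∀ (x : E3) (t : ℝ), (x, t) ∈ D →
    deriv (fun s => deriv (fun s' => u x s') s) t - Laplacian.laplacian (fun y => u y t) x
      = (deriv (fun s => u x s) t) ^ 2 - ‖gradient (fun y => u y t) x‖ ^ 2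
  initial_value : ∀ x : E3, u x 0 = u₀ x
  initial_velocity : ∀ x : E3, deriv (fun s => u x s) 0 = u₁ x

/-- `(D, u)` is the solution with data `(u₀, u₁)` on its maximal domain: every classical solution
with the same data lives on a subset of `D` and agrees with `u` there. -/
def IsMaximalSolution (u₀ u₁ : E3 → ℝ) (D : Set (E3 × ℝ)) (u : E3 → ℝ → ℝ) : Prop :=
  IsClassicalSolution u₀ u₁ D u ∧
    ∀ (D' : Set (E3 × ℝ)) (u' : E3 → ℝ → ℝ), IsClassicalSolution u₀ u₁ D' u' →
      D' ⊆ D ∧ ∀ (x : E3) (t : ℝ), (x, t) ∈ D' → u' x t = u x t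

/-- The part of the ball `|x - x₀| ≤ 1` on which the solution with domain `D` is defined at
time `t`. -/
def ballSlice (D : Set (E3 × ℝ)) (x₀ : E3) (t : ℝ) : Set E3 :=
  {x | ‖x - x₀‖ ≤ 1 ∧ (x, t) ∈ D}

/-- The `L^∞(S)` norm, with values in `[0, ∞]`. -/
noncomputable def normLInfty (S : Set E3) (f : E3 → ℝ) : ℝ≥0∞ :=
  eLpNorm f ∞ (volume.restrict S)

/-- The `H^{3/2}(S)` norm, with values in `[0, ∞]`, of a function that is `C¹` in a neighbourhood of
each point of `S ⊆ ℝ³` (Sobolev-Slobodeckij form):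
`‖f‖² = ∫_S |f|² + ∫_S |∇f|² + ∫_S ∫_S |∇f(x) - ∇f(y)|² / |x - y|⁴ dy dx`;
the exponent is `3 + 2 · (1/2) = 4`. -/
noncomputable def normHThreeHalves (S : Set E3) (f : E3 → ℝ) : ℝ≥0∞ :=
  ((∫⁻ x in S, ‖f x‖ₑ ^ 2) + (∫⁻ x in S, ‖gradient f x‖ₑ ^ 2)
    + ∫⁻ x in S, ∫⁻ y in S, ‖gradient f x - gradient f y‖ₑ ^ 2 / ‖x - y‖ₑ ^ 4) ^ (1 / 2 : ℝ)

/-! The substitution v = exp(-u) linearises the problem: the chain rule gives □(f∘u) = f''(u)(u_t² -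
|∇u|²) + f'(u)□u, and f(s) = exp(-s) cancels the nonlinearity (`waveOp_comp`). So u = -log v, where
v is the global smooth solution of the linear wave equation with data exp(-u₀), -u₁ exp(-u₀).

For radial data v is explicit. With P' = p and r = |x|, r·v = P(t+r) - P(t-r), that is v =
∫_{-1}^{1} p(t+σr) dσ, where p is half of (s e^{-u₀})' - s u₁ e^{-u₀}. On the axis v(0,t) = 2p(t),
and p(s) is a positive multiple of 1 - s(u₀)_r(s) - s u₁(s). The hypothesis at r₀ therefore says
p(r₀) ≤ 0 or p(-r₀) ≤ 0, while p(0) > 0; so v vanishes on the axis at a first time t₀ with |t₀| ≤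
r₀.

The maximal domain consists of the points whose light cone lies in {v > 0}. For any other classical
solution u', exp(-u') solves the same linear problem, so it equals v by an energy estimate in cones
(`eq_zero_of_wave`); hence v > 0 on its domain (`isMaximalSolution_neg_log`).

Since v is differentiable at the apex and vanishes there, v ≤ M|t-t₀| for |x| ≤ |t-t₀| wherever it
is positive, which gives the sup-norm bound. For H^{3/2}, ∇u = G(r)x, and comparing ∇u at nearly
orthogonal points bounds the seminorm below by a multiple of ∫ G² r³ dr. By the weighted AM-GM
inequality this controls |u(b) - u(a)| up to log(b/a)/4 (`gagliardoHalf_ge`). At radius |t-t₀| the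
value of u is nearly the full logarithm L. Either u ≥ L/8 on a fixed annulus, so that the L² part is
of order L², or u drops by enough to make the seminorm at least a multiple of L. If v(·,t) already
vanishes at a small radius, the seminorm is infinite. That the slice of the domain is large enough
for this is `exists_mem_positivityDomain_near_apex`. -/

/-! ### Smooth radial means and d'Alembert's formula. -/

/-- Weighted means of `q` over the interval with centre `t` and radius `r`. -/
noncomputable def weightedMean (k : ℕ) (q : ℝ → ℝ) (r t : ℝ) : ℝ :=
  ∫ σ in (-1 : ℝ)..1, (1 - σ ^ 2) ^ k * q (t + σ * r)

theorem weightedMean_neg_time (k : ℕ) (q : ℝ → ℝ) (r t : ℝ) :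
    weightedMean k q r (-t) = weightedMean k (fun s => q (-s)) r t := by
  have h := intervalIntegral.integral_comp_neg (a := (-1 : ℝ)) (b := 1)
    (fun σ => (1 - σ ^ 2) ^ k * q (-t + σ * r))
  simp only [neg_neg] at h
  unfold weightedMean
  rw [← h]
  refine intervalIntegral.integral_congr fun σ _ => ?_
  simp only
  congr 2 <;> ring_nf

theorem hasFDerivAt_weightedMean (k : ℕ) {q : ℝ → ℝ} (hq : ContDiff ℝ 1 q) (z : ℝ × ℝ) :
    HasFDerivAt (fun z : ℝ × ℝ => weightedMean k q z.1 z.2)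
      ((∫ σ in (-1 : ℝ)..1, (1 - σ ^ 2) ^ k * σ * deriv q (z.2 + σ * z.1)) •
          ContinuousLinearMap.fst ℝ ℝ ℝ
        + weightedMean k (deriv q) z.1 z.2 • ContinuousLinearMap.snd ℝ ℝ ℝ) z := by
  have hq' : Continuous (deriv q) := hq.continuous_deriv le_rfl
  have hqc : Continuous q := hq.continuous
  set F' : ℝ × ℝ → ℝ → (ℝ × ℝ →L[ℝ] ℝ) := fun z σ =>
    ((1 - σ ^ 2) ^ k * σ * deriv q (z.2 + σ * z.1)) • ContinuousLinearMap.fst ℝ ℝ ℝ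
      + ((1 - σ ^ 2) ^ k * deriv q (z.2 + σ * z.1)) • ContinuousLinearMap.snd ℝ ℝ ℝ with hF'
  have hF'c : Continuous (fun p : (ℝ × ℝ) × ℝ => F' p.1 p.2) := by
    simp only [hF']; fun_prop
  obtain ⟨C, hC⟩ := ((isCompact_closedBall z 1).prod
    (isCompact_Icc (a := (-1 : ℝ)) (b := 1))).exists_bound_of_continuousOn hF'c.continuousOn
  have key := intervalIntegral.hasFDerivAt_integral_of_dominated_of_fderiv_le (𝕜 := ℝ)
    (μ := volume) (a := (-1 : ℝ)) (b := 1) (x₀ := z) (s := Metric.closedBall z 1)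
    (F := fun z σ => (1 - σ ^ 2) ^ k * q (z.2 + σ * z.1)) (F' := F') (bound := fun _ => C)
    (Metric.closedBall_mem_nhds z one_pos)
    (Eventually.of_forall fun w => (by fun_prop : Continuous fun σ : ℝ =>
      (1 - σ ^ 2) ^ k * q (w.2 + σ * w.1)).aestronglyMeasurable)
    ((by fun_prop : Continuous fun σ : ℝ =>
      (1 - σ ^ 2) ^ k * q (z.2 + σ * z.1)).intervalIntegrable _ _)
    ((by fun_prop : Continuous (F' z)).aestronglyMeasurable)
    (Eventually.of_forall fun σ hσ w hw => by
      rw [uIoc_of_le (by norm_num)] at hσ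
      exact hC (w, σ) ⟨hw, hσ.1.le, hσ.2⟩)
    intervalIntegrable_const
    (Eventually.of_forall fun σ _ w _ => by
      have h1 : HasFDerivAt (fun w : ℝ × ℝ => w.2 + σ * w.1)
          (ContinuousLinearMap.snd ℝ ℝ ℝ + σ • ContinuousLinearMap.fst ℝ ℝ ℝ) w :=
        hasFDerivAt_snd.add (hasFDerivAt_fst.const_mul σ)
      have h2 := ((hq.differentiable one_ne_zero (w.2 + σ * w.1)).hasDerivAt.comp_hasFDerivAt w
        h1).const_mul ((1 - σ ^ 2) ^ k)
      refine h2.congr_fderiv ?_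
      ext
      · simp [hF']; ring
      · simp [hF'])
  refine key.congr_fderiv ?_
  simp only [hF']
  rw [intervalIntegral.integral_add, intervalIntegral.integral_smul_const,
    intervalIntegral.integral_smul_const]
  · rfl
  · exact (by fun_prop : Continuous fun σ : ℝ => ((1 - σ ^ 2) ^ k * σ * deriv q (z.2 + σ * z.1)) •
      ContinuousLinearMap.fst ℝ ℝ ℝ).intervalIntegrable _ _
  · exact (by fun_prop : Continuous fun σ : ℝ => ((1 - σ ^ 2) ^ k * deriv q (z.2 + σ * z.1)) •
      ContinuousLinearMap.snd ℝ ℝ ℝ).intervalIntegrable _ _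

/-- Integration by parts: σ(1-σ²)^k is, up to a factor, the derivative of (1-σ²)^(k+1), which
vanishes at ±1. The factor r gained here cancels the 1/r in the gradient of |x|, so nothing singular
occurs on the axis. -/
theorem integral_weight_mul_id_mul (k : ℕ) {q : ℝ → ℝ} (hq : ContDiff ℝ 1 q) (r t : ℝ) :
    ∫ σ in (-1 : ℝ)..1, (1 - σ ^ 2) ^ k * σ * q (t + σ * r)
      = r * (1 / (2 * (k + 1)) * weightedMean (k + 1) (deriv q) r t) := by
  have hq' : Continuous (deriv q) := hq.continuous_deriv le_rfl
  have hqc : Continuous q := hq.continuous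
  have hk : (2 * ((k : ℝ) + 1)) ≠ 0 := by positivity
  have hder : ∀ σ ∈ uIcc (-1 : ℝ) 1, HasDerivAt
      (fun σ : ℝ => 1 / (2 * ((k : ℝ) + 1)) * ((1 - σ ^ 2) ^ (k + 1) * q (t + σ * r)))
      (r * (1 / (2 * ((k : ℝ) + 1)) * ((1 - σ ^ 2) ^ (k + 1) * deriv q (t + σ * r)))
        - (1 - σ ^ 2) ^ k * σ * q (t + σ * r)) σ := by
    intro σ _
    have h1 : HasDerivAt (fun σ : ℝ => 1 - σ ^ 2) (-(2 * σ)) σ := by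
      simpa using (hasDerivAt_pow 2 σ).const_sub 1
    have h2 : HasDerivAt (fun σ : ℝ => t + σ * r) r σ := by
      simpa using ((hasDerivAt_id σ).mul_const r).const_add t
    have h3 := (hq.differentiable one_ne_zero (t + σ * r)).hasDerivAt.comp σ h2
    refine (((h1.pow (k + 1)).mul h3).const_mul (1 / (2 * ((k : ℝ) + 1)))).congr_deriv ?_
    simp only [Function.comp_apply, Nat.add_sub_cancel, Nat.cast_add, Nat.cast_one, Pi.pow_apply]
    field_simp
    ring
  have hI1 : IntervalIntegrable (fun σ : ℝ => r * (1 / (2 * ((k : ℝ) + 1)) *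
      ((1 - σ ^ 2) ^ (k + 1) * deriv q (t + σ * r)))) volume (-1) 1 :=
    (by fun_prop : Continuous _).intervalIntegrable _ _
  have hI2 : IntervalIntegrable (fun σ : ℝ => (1 - σ ^ 2) ^ k * σ * q (t + σ * r)) volume (-1) 1 :=
    (by fun_prop : Continuous _).intervalIntegrable _ _
  have h := intervalIntegral.integral_eq_sub_of_hasDerivAt hder (hI1.sub hI2)
  rw [intervalIntegral.integral_sub hI1 hI2, intervalIntegral.integral_const_mul,
    intervalIntegral.integral_const_mul] at h
  norm_num at h
  unfold weightedMean
  simp only [one_div, mul_inv] at h ⊢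
  linarith

/-- The function of `(x, t)` obtained from a weighted mean with `r = |x|`. -/
noncomputable def radialMean (k : ℕ) (q : ℝ → ℝ) (p : E3 × ℝ) : ℝ :=
  weightedMean k q ‖p.1‖ p.2

theorem hasFDerivAt_radialMean (k : ℕ) {q : ℝ → ℝ} (hq : ContDiff ℝ 2 q) (p : E3 × ℝ) :
    HasFDerivAt (radialMean k q)
      ((1 / (2 * ((k : ℝ) + 1)) * radialMean (k + 1) (deriv (deriv q)) p) •
          ((innerSL ℝ p.1).comp (ContinuousLinearMap.fst ℝ E3 ℝ))
        + radialMean k (deriv q) p • ContinuousLinearMap.snd ℝ E3 ℝ) p := by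
  have hq1 : ContDiff ℝ 1 q := hq.of_le (by norm_num)
  have hq' : ContDiff ℝ 1 (deriv q) := by
    have : ContDiff ℝ (1 + 1) q := hq.of_le (by norm_num)
    exact ((contDiff_succ_iff_deriv).1 this).2.2
  have h := hasFDerivAt_weightedMean k hq1 (‖p.1‖, p.2)
  simp only [integral_weight_mul_id_mul k hq'] at h
  obtain ⟨x, t⟩ := p
  -- The norm is not differentiable at 0, but the radial derivative carries a factor r and vanishes
  -- there, so the first-order expansion survives composition with the norm.
  by_cases hx : x = 0
  · subst hx
    rw [hasFDerivAt_iff_isLittleO] at h ⊢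
    have hΦ : Tendsto (fun p : E3 × ℝ => (‖p.1‖, p.2)) (𝓝 ((0 : E3), t)) (𝓝 (‖(0 : E3)‖, t)) :=
      Continuous.tendsto' (by fun_prop) _ _ rfl
    refine ((h.comp_tendsto hΦ).congr_left ?_).trans_isBigO ?_
    · intro p
      simp [radialMean]
    · refine Asymptotics.IsBigO.of_bound 1 (Eventually.of_forall fun p => ?_)
      simp [Prod.norm_def]
  · have hn : HasFDerivAt (fun y : E3 => ‖y‖) (‖x‖⁻¹ • innerSL ℝ x) x := by
      have h1 : HasFDerivAt (fun y : E3 => ‖y‖ ^ 2) (2 • innerSL ℝ x) x :=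
        (hasStrictFDerivAt_norm_sq x).hasFDerivAt
      have h2 := h1.sqrt (by positivity)
      simp only [Real.sqrt_sq (norm_nonneg _)] at h2
      refine h2.congr_fderiv ?_
      ext y
      simp
      field_simp
    have hΦ : HasFDerivAt (fun p : E3 × ℝ => (‖p.1‖, p.2)) _ (x, t) :=
      (HasFDerivAt.comp (g := fun y : E3 => ‖y‖) (x, t) hn hasFDerivAt_fst).prodMk hasFDerivAt_snd
    refine (HasFDerivAt.comp (x, t) h hΦ).congr_fderiv ?_
    have : ‖x‖ ≠ 0 := by simpa using hx
    ext y <;> simp [radialMean]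
    field_simp

theorem continuous_weightedMean (k : ℕ) {q : ℝ → ℝ} (hq : ContDiff ℝ 1 q) :
    Continuous (fun z : ℝ × ℝ => weightedMean k q z.1 z.2) :=
  continuous_iff_continuousAt.2 fun z => (hasFDerivAt_weightedMean k hq z).continuousAt

theorem contDiff_infty_deriv {q : ℝ → ℝ} (hq : ContDiff ℝ ∞ q) : ContDiff ℝ ∞ (deriv q) :=
  (contDiff_infty_iff_deriv.1 hq).2

/-- Differentiation stays within the family: it replaces (k, q) by (k+1, q'') with a factor x, or by
(k, q'). Hence the induction runs over all k and q at once. -/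
theorem contDiff_radialMean (k : ℕ) {q : ℝ → ℝ} (hq : ContDiff ℝ ∞ q) :
    ContDiff ℝ ∞ (radialMean k q) := by
  refine contDiff_infty.2 fun n => ?_
  induction n generalizing k q with
  | zero =>
    refine contDiff_zero.2 (continuous_iff_continuousAt.2 fun p => ?_)
    exact (hasFDerivAt_radialMean k (contDiff_infty.1 hq 2) p).continuousAt
  | succ n ih =>
    have hd := hasFDerivAt_radialMean k (contDiff_infty.1 hq 2)
    have h1 := ih (k + 1) (contDiff_infty_deriv (contDiff_infty_deriv hq))
    have h2 := ih k (contDiff_infty_deriv hq)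
    push_cast
    refine contDiff_succ_iff_fderiv.2 ⟨fun p => (hd p).differentiableAt, by simp, ?_⟩
    rw [funext fun p => (hd p).fderiv]
    have h3 : ContDiff ℝ n (fun p : E3 × ℝ =>
        (innerSL ℝ p.1).comp (ContinuousLinearMap.fst ℝ E3 ℝ)) :=
      ((innerSL ℝ (E := E3)).contDiff.comp contDiff_fst).clm_comp contDiff_const
    exact ((contDiff_const.mul h1).smul h3).add (h2.smul contDiff_const)

/-- Applied to q'', this is the wave equation for the unweighted mean: the left side is its second
time derivative and the right side its Laplacian in dimension three. The difference of the
integrands is an exact derivative with vanishing boundary values. -/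
theorem weightedMean_zero_eq (q : ℝ → ℝ) (hq : ContDiff ℝ 2 q) (r t : ℝ) :
    weightedMean 0 q r t = 3 / 2 * weightedMean 1 q r t
      + r ^ 2 / 8 * weightedMean 2 (deriv (deriv q)) r t := by
  have hq' : ContDiff ℝ 1 (deriv q) := by
    have : ContDiff ℝ (1 + 1) q := hq.of_le (by norm_num)
    exact ((contDiff_succ_iff_deriv).1 this).2.2
  have hqc : Continuous q := hq.continuous
  have hqc' : Continuous (deriv q) := hq'.continuous
  have hqc'' : Continuous (deriv (deriv q)) := hq'.continuous_deriv le_rfl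
  have hder : ∀ σ ∈ uIcc (-1 : ℝ) 1, HasDerivAt
      (fun σ : ℝ => r / 8 * ((1 - σ ^ 2) ^ 2 * deriv q (t + σ * r))
        + 1 / 2 * (σ * ((1 - σ ^ 2) * q (t + σ * r))))
      ((3 / 2 * ((1 - σ ^ 2) ^ 1 * q (t + σ * r))
        + r ^ 2 / 8 * ((1 - σ ^ 2) ^ 2 * deriv (deriv q) (t + σ * r)))
        - (1 - σ ^ 2) ^ 0 * q (t + σ * r)) σ := by
    intro σ _
    have h1 : HasDerivAt (fun σ : ℝ => 1 - σ ^ 2) (-(2 * σ)) σ := by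
      simpa using (hasDerivAt_pow 2 σ).const_sub 1
    have h2 : HasDerivAt (fun σ : ℝ => t + σ * r) r σ := by
      simpa using ((hasDerivAt_id σ).mul_const r).const_add t
    have h3 := (hq.differentiable (by norm_num) (t + σ * r)).hasDerivAt.comp σ h2
    have h4 := (hq'.differentiable one_ne_zero (t + σ * r)).hasDerivAt.comp σ h2
    refine ((((h1.pow 2).mul h4).const_mul (r / 8)).add
      (((hasDerivAt_id σ).mul (h1.mul h3)).const_mul (1 / 2))).congr_deriv ?_
    simp only [Function.comp_apply, Pi.pow_apply, Pi.mul_apply, id]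
    push_cast
    ring
  have hI0 : IntervalIntegrable (fun σ : ℝ => (1 - σ ^ 2) ^ 0 * q (t + σ * r)) volume (-1) 1 :=
    (by fun_prop : Continuous _).intervalIntegrable _ _
  have hI1 : IntervalIntegrable (fun σ : ℝ => 3 / 2 * ((1 - σ ^ 2) ^ 1 * q (t + σ * r)))
    volume (-1) 1 := (by fun_prop : Continuous _).intervalIntegrable _ _
  have hI2 : IntervalIntegrable (fun σ : ℝ => r ^ 2 / 8 *
    ((1 - σ ^ 2) ^ 2 * deriv (deriv q) (t + σ * r))) volume (-1) 1 :=
    (by fun_prop : Continuous _).intervalIntegrable _ _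
  have h := intervalIntegral.integral_eq_sub_of_hasDerivAt hder ((hI1.add hI2).sub hI0)
  rw [intervalIntegral.integral_sub (hI1.add hI2) hI0, intervalIntegral.integral_add hI1 hI2,
    intervalIntegral.integral_const_mul, intervalIntegral.integral_const_mul] at h
  norm_num at h
  unfold weightedMean
  norm_num
  linarith

theorem radius_mul_weightedMean_zero {q : ℝ → ℝ} (hq : Continuous q) (r t : ℝ) :
    r * weightedMean 0 q r t = (∫ s in (0 : ℝ)..(t + r), q s) - ∫ s in (0 : ℝ)..(t - r), q s := by
  have h := intervalIntegral.smul_integral_comp_add_mul (a := (-1 : ℝ)) (b := 1) q r t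
  have : weightedMean 0 q r t = ∫ σ in (-1 : ℝ)..1, q (t + r * σ) := by
    unfold weightedMean
    refine intervalIntegral.integral_congr fun σ _ => ?_
    simp [mul_comm]
  rw [this, ← smul_eq_mul, h, intervalIntegral.integral_interval_sub_left
    (hq.intervalIntegrable _ _) (hq.intervalIntegrable _ _)]
  rw [mul_neg_one, mul_one, ← sub_eq_add_neg]

theorem weightedMean_zero_radius_zero (q : ℝ → ℝ) (t : ℝ) : weightedMean 0 q 0 t = 2 * q t := by
  simp [weightedMean]; norm_num

theorem weightedMean_zero_of_odd {q : ℝ → ℝ} (hq : ∀ s, q (-s) = -q s) (k : ℕ) (r : ℝ) :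
    weightedMean k q r 0 = 0 := by
  have h := weightedMean_neg_time k q r 0
  simp only [hq, neg_zero] at h
  have h2 : weightedMean k (fun s => -q s) r 0 = - weightedMean k q r 0 := by
    simp [weightedMean, ← intervalIntegral.integral_neg]
  linarith

/-- The integrand is the derivative of σ α(σr) in σ, so the integral is α(r) + α(-r). -/
theorem weightedMean_deriv_id_mul {α : ℝ → ℝ} (hα : ContDiff ℝ 1 α) (he : ∀ s, α (-s) = α s)
    (r : ℝ) : weightedMean 0 (deriv fun s => s * α s) r 0 = 2 * α r := by
  have hd : ∀ s, HasDerivAt (fun s => s * α s) (α s + s * deriv α s) s := fun s => by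
    simpa using (hasDerivAt_id' s).fun_mul (hα.differentiable one_ne_zero s).hasDerivAt
  have hc : Continuous (deriv α) := hα.continuous_deriv le_rfl
  have hc' : Continuous α := hα.continuous
  have hder : ∀ σ ∈ uIcc (-1 : ℝ) 1, HasDerivAt (fun σ : ℝ => σ * α (σ * r))
      (α (σ * r) + σ * r * deriv α (σ * r)) σ := by
    intro σ _
    have h2 : HasDerivAt (fun σ : ℝ => σ * r) r σ := by
      simpa using (hasDerivAt_id σ).mul_const r
    have h3 := (hα.differentiable one_ne_zero (σ * r)).hasDerivAt.comp σ h2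
    refine ((hasDerivAt_id σ).mul h3).congr_deriv ?_
    simp; ring
  have h := intervalIntegral.integral_eq_sub_of_hasDerivAt hder
    ((by fun_prop : Continuous _).intervalIntegrable _ _)
  unfold weightedMean
  simp only [(hd _).deriv, pow_zero, one_mul, zero_add]
  rw [h]
  simp [he]; ring

theorem deriv_odd_of_even {f : ℝ → ℝ} (h : ∀ s, f (-s) = f s) (s : ℝ) :
    deriv f (-s) = -deriv f s := by
  have h1 := deriv_comp_neg f s
  rw [funext h] at h1
  linarith

theorem deriv_even_of_odd {f : ℝ → ℝ} (h : ∀ s, f (-s) = -f s) (s : ℝ) :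
    deriv f (-s) = deriv f s := by
  have h1 := deriv_comp_neg f s
  rw [funext h, deriv.fun_neg] at h1
  linarith

/-! ### Space-time directional derivatives and the wave operator. -/

/-- Coordinate directions of `ℝ³ × ℝ`. -/
noncomputable def spaceDir (i : Fin 3) : E3 × ℝ := (EuclideanSpace.single i 1, 0)

/-- The time direction of `ℝ³ × ℝ`. -/
noncomputable def timeDir : E3 × ℝ := (0, 1)

/-- Derivative of `F` in the direction `a`. -/
noncomputable def dirDeriv (a : E3 × ℝ) (F : E3 × ℝ → ℝ) (p : E3 × ℝ) : ℝ := fderiv ℝ F p a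

theorem dirDeriv_time_radialMean (k : ℕ) {q : ℝ → ℝ} (hq : ContDiff ℝ 2 q) :
    dirDeriv timeDir (radialMean k q) = radialMean k (deriv q) := by
  funext p
  simp [dirDeriv, timeDir, (hasFDerivAt_radialMean k hq p).fderiv]

theorem dirDeriv_space_radialMean (k : ℕ) {q : ℝ → ℝ} (hq : ContDiff ℝ 2 q) (i : Fin 3) :
    dirDeriv (spaceDir i) (radialMean k q) = fun p =>
      1 / (2 * ((k : ℝ) + 1)) * (radialMean (k + 1) (deriv (deriv q)) p * p.1 i) := by
  funext p
  simp [dirDeriv, spaceDir, (hasFDerivAt_radialMean k hq p).fderiv, EuclideanSpace.inner_single_right]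
  ring

/-- The d'Alembert operator applied to `F`. -/
noncomputable def waveOp (F : E3 × ℝ → ℝ) (p : E3 × ℝ) : ℝ :=
  dirDeriv timeDir (dirDeriv timeDir F) p - ∑ i, dirDeriv (spaceDir i) (dirDeriv (spaceDir i) F) p

theorem waveOp_radialMean_zero {q : ℝ → ℝ} (hq : ContDiff ℝ ∞ q) (p : E3 × ℝ) :
    waveOp (radialMean 0 q) p = 0 := by
  have hq1 := contDiff_infty_deriv hq
  have hq2 := contDiff_infty_deriv hq1
  have hs : ∀ i, dirDeriv (spaceDir i) (dirDeriv (spaceDir i) (radialMean 0 q)) p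
      = 1 / 2 * (radialMean 1 (deriv (deriv q)) p + 1 / 4 *
        (radialMean 2 (deriv (deriv (deriv (deriv q)))) p * p.1 i ^ 2)) := by
    intro i
    rw [dirDeriv_space_radialMean 0 (contDiff_infty.1 hq 2)]
    have h1 := hasFDerivAt_radialMean 1 (contDiff_infty.1 hq2 2) p
    have h2 : HasFDerivAt (fun p : E3 × ℝ => p.1 i)
        ((EuclideanSpace.proj (𝕜 := ℝ) i).comp (ContinuousLinearMap.fst ℝ E3 ℝ)) p :=
      ((EuclideanSpace.proj (𝕜 := ℝ) i).comp (ContinuousLinearMap.fst ℝ E3 ℝ)).hasFDerivAt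
    have h3 := (h1.fun_mul h2).const_mul (1 / 2)
    simp only [dirDeriv, Nat.cast_zero, zero_add, mul_one]
    rw [h3.fderiv]
    simp [spaceDir, EuclideanSpace.inner_single_right]
    ring
  unfold waveOp
  rw [dirDeriv_time_radialMean 0 (contDiff_infty.1 hq 2),
    dirDeriv_time_radialMean 0 (contDiff_infty.1 hq1 2), Finset.sum_congr rfl fun i _ => hs i]
  have hn : ‖p.1‖ ^ 2 = ∑ i, p.1 i ^ 2 := by
    rw [EuclideanSpace.norm_sq_eq]; simp
  have := weightedMean_zero_eq _ (contDiff_infty.1 hq2 2) ‖p.1‖ p.2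
  rw [hn] at this
  simp only [Fin.sum_univ_three, radialMean] at this ⊢
  linarith

theorem dirDeriv_congr {a : E3 × ℝ} {F G : E3 × ℝ → ℝ} {D : Set (E3 × ℝ)} (hD : IsOpen D)
    (h : ∀ p ∈ D, F p = G p) : ∀ p ∈ D, dirDeriv a F p = dirDeriv a G p := fun p hp => by
  have : F =ᶠ[𝓝 p] G := eventually_of_mem (hD.mem_nhds hp) h
  unfold dirDeriv
  rw [this.fderiv_eq]

theorem ContDiffOn.dirDeriv {F : E3 × ℝ → ℝ} {D : Set (E3 × ℝ)} {m n : WithTop ℕ∞} (hD : IsOpen D)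
    (hF : ContDiffOn ℝ n F D) (hmn : m + 1 ≤ n) (a : E3 × ℝ) :
    ContDiffOn ℝ m (_root_.dirDeriv a F) D :=
  (hF.fderiv_of_isOpen hD hmn).clm_apply contDiffOn_const

theorem waveOp_congr {F G : E3 × ℝ → ℝ} {D : Set (E3 × ℝ)} (hD : IsOpen D)
    (h : ∀ p ∈ D, F p = G p) : ∀ p ∈ D, waveOp F p = waveOp G p := fun p hp => by
  unfold waveOp
  rw [dirDeriv_congr hD (dirDeriv_congr hD h) p hp,
    Finset.sum_congr rfl fun i _ => dirDeriv_congr hD (dirDeriv_congr hD h) p hp]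

theorem deriv_time_eq {U : E3 × ℝ → ℝ} {x : E3} {t : ℝ} (hU : DifferentiableAt ℝ U (x, t)) :
    deriv (fun s => U (x, s)) t = dirDeriv timeDir U (x, t) := by
  have h1 : HasDerivAt (fun s : ℝ => (x, s)) timeDir t :=
    (hasDerivAt_const t x).prodMk (hasDerivAt_id t)
  exact (hU.hasFDerivAt.comp_hasDerivAt t h1).deriv

theorem deriv_deriv_time_eq {U : E3 × ℝ → ℝ} {D : Set (E3 × ℝ)} (hD : IsOpen D)
    (hU : ContDiffOn ℝ 2 U D) {x : E3} {t : ℝ} (hp : (x, t) ∈ D) :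
    deriv (fun s => deriv (fun s' => U (x, s')) s) t
      = dirDeriv timeDir (dirDeriv timeDir U) (x, t) := by
  have hev : (fun s => deriv (fun s' => U (x, s')) s) =ᶠ[𝓝 t] fun s => dirDeriv timeDir U (x, s) := by
    have : ∀ᶠ s in 𝓝 t, (x, s) ∈ D :=
      (Continuous.prodMk_right x).continuousAt.eventually (hD.mem_nhds hp)
    filter_upwards [this] with s hs
    exact deriv_time_eq ((hU.differentiableOn (by norm_num)).differentiableAt (hD.mem_nhds hs))
  rw [hev.deriv_eq]
  exact deriv_time_eq (((hU.dirDeriv hD (m := 1) (by norm_num) timeDir).differentiableOn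
    one_ne_zero).differentiableAt (hD.mem_nhds hp))

theorem fderiv_slice_eq {U : E3 × ℝ → ℝ} {x : E3} {t : ℝ} (hU : DifferentiableAt ℝ U (x, t))
    (i : Fin 3) : fderiv ℝ (fun y => U (y, t)) x (EuclideanSpace.single i 1)
      = dirDeriv (spaceDir i) U (x, t) := by
  have h1 : HasFDerivAt (fun y : E3 => (y, t)) (ContinuousLinearMap.inl ℝ E3 ℝ) x :=
    hasFDerivAt_prodMk_left x t
  have h2 := hU.hasFDerivAt.comp x h1
  have h3 : fderiv ℝ (fun y => U (y, t)) x
      = (fderiv ℝ U (x, t)).comp (ContinuousLinearMap.inl ℝ E3 ℝ) := h2.fderiv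
  rw [h3]; rfl

theorem norm_gradient_slice_sq {U : E3 × ℝ → ℝ} {x : E3} {t : ℝ}
    (hU : DifferentiableAt ℝ U (x, t)) :
    ‖gradient (fun y => U (y, t)) x‖ ^ 2 = ∑ i, dirDeriv (spaceDir i) U (x, t) ^ 2 := by
  rw [EuclideanSpace.norm_sq_eq]
  refine Finset.sum_congr rfl fun i _ => ?_
  rw [← fderiv_slice_eq hU i, ← InnerProductSpace.toDual_symm_apply (𝕜 := ℝ),
    EuclideanSpace.inner_single_right]
  simp [gradient]

theorem laplacian_slice_eq {U : E3 × ℝ → ℝ} {D : Set (E3 × ℝ)} (hD : IsOpen D)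
    (hU : ContDiffOn ℝ 2 U D) {x : E3} {t : ℝ} (hp : (x, t) ∈ D) :
    Laplacian.laplacian (fun y => U (y, t)) x
      = ∑ i, dirDeriv (spaceDir i) (dirDeriv (spaceDir i) U) (x, t) := by
  rw [InnerProductSpace.laplacian_eq_iteratedFDeriv_orthonormalBasis _
    (EuclideanSpace.basisFun (Fin 3) ℝ)]
  refine Finset.sum_congr rfl fun i _ => ?_
  rw [iteratedFDeriv_two_apply]
  simp only [EuclideanSpace.basisFun_apply, Matrix.cons_val_zero, Matrix.cons_val_one]
  have hslice : ContDiffAt ℝ 2 (fun y => U (y, t)) x :=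
    (hU.contDiffAt (hD.mem_nhds hp)).comp x (by fun_prop)
  have hdf : DifferentiableAt ℝ (fderiv ℝ fun y => U (y, t)) x :=
    (hslice.fderiv_right (m := 1) (by norm_num)).differentiableAt one_ne_zero
  have h1 : fderiv ℝ (fderiv ℝ fun y => U (y, t)) x (EuclideanSpace.single i 1)
      (EuclideanSpace.single i 1)
      = fderiv ℝ (fun z => fderiv ℝ (fun y => U (y, t)) z (EuclideanSpace.single i 1)) x
        (EuclideanSpace.single i 1) := by
    rw [fderiv_clm_apply hdf (by fun_prop)]
    simp
  rw [h1]
  have hev : (fun z => fderiv ℝ (fun y => U (y, t)) z (EuclideanSpace.single i 1))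
      =ᶠ[𝓝 x] fun z => dirDeriv (spaceDir i) U (z, t) := by
    have : ∀ᶠ z in 𝓝 x, (z, t) ∈ D :=
      (Continuous.prodMk_left t).continuousAt.eventually (hD.mem_nhds hp)
    filter_upwards [this] with z hz
    exact fderiv_slice_eq ((hU.differentiableOn (by norm_num)).differentiableAt (hD.mem_nhds hz)) i
  rw [hev.fderiv_eq]
  exact fderiv_slice_eq (((hU.dirDeriv hD (m := 1) (by norm_num) (spaceDir i)).differentiableOn
    one_ne_zero).differentiableAt (hD.mem_nhds hp)) i

/-! ### The null form and the logarithmic substitution. -/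

/-- The quadratic form `u_t² - |∇u|²`. -/
noncomputable def nullForm (F : E3 × ℝ → ℝ) (p : E3 × ℝ) : ℝ :=
  dirDeriv timeDir F p ^ 2 - ∑ i, dirDeriv (spaceDir i) F p ^ 2

theorem equation_iff_waveOp_eq_nullForm {U : E3 × ℝ → ℝ} {D : Set (E3 × ℝ)} (hD : IsOpen D)
    (hU : ContDiffOn ℝ 2 U D) {x : E3} {t : ℝ} (hp : (x, t) ∈ D) :
    (deriv (fun s => deriv (fun s' => U (x, s')) s) t - Laplacian.laplacian (fun y => U (y, t)) x
      = (deriv (fun s => U (x, s)) t) ^ 2 - ‖gradient (fun y => U (y, t)) x‖ ^ 2)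
      ↔ waveOp U (x, t) = nullForm U (x, t) := by
  have hd := (hU.differentiableOn (by norm_num)).differentiableAt (hD.mem_nhds hp)
  rw [deriv_deriv_time_eq hD hU hp, laplacian_slice_eq hD hU hp, deriv_time_eq hd,
    norm_gradient_slice_sq hd]
  rfl

theorem dirDeriv_comp {U : E3 × ℝ → ℝ} {f : ℝ → ℝ} {f' : ℝ} {p a : E3 × ℝ}
    (hU : DifferentiableAt ℝ U p) (hf : HasDerivAt f f' (U p)) :
    dirDeriv a (fun q => f (U q)) p = f' * dirDeriv a U p := by
  have := hf.comp_hasFDerivAt p hU.hasFDerivAt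
  unfold dirDeriv
  rw [show (fun q => f (U q)) = f ∘ U from rfl, this.fderiv]
  simp

theorem dirDeriv_mul {F G : E3 × ℝ → ℝ} {p a : E3 × ℝ}
    (hF : DifferentiableAt ℝ F p) (hG : DifferentiableAt ℝ G p) :
    dirDeriv a (fun q => F q * G q) p = dirDeriv a F p * G p + F p * dirDeriv a G p := by
  unfold dirDeriv
  rw [fderiv_fun_mul hF hG]
  simp; ring

theorem dirDeriv_dirDeriv_comp {U : E3 × ℝ → ℝ} {D : Set (E3 × ℝ)} (hD : IsOpen D)
    (hU : ContDiffOn ℝ 2 U D) {f f' f'' : ℝ → ℝ} (hf : ∀ q ∈ D, HasDerivAt f (f' (U q)) (U q))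
    (hf' : ∀ q ∈ D, HasDerivAt f' (f'' (U q)) (U q)) (a : E3 × ℝ) {p : E3 × ℝ} (hp : p ∈ D) :
    dirDeriv a (dirDeriv a fun q => f (U q)) p
      = f'' (U p) * dirDeriv a U p ^ 2 + f' (U p) * dirDeriv a (dirDeriv a U) p := by
  have hd : ∀ q ∈ D, DifferentiableAt ℝ U q := fun q hq =>
    (hU.differentiableOn (by norm_num)).differentiableAt (hD.mem_nhds hq)
  have hd2 : DifferentiableAt ℝ (dirDeriv a U) p :=
    ((hU.dirDeriv hD (m := 1) (by norm_num) a).differentiableOn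
      one_ne_zero).differentiableAt (hD.mem_nhds hp)
  rw [dirDeriv_congr hD (fun q hq => dirDeriv_comp (hd q hq) (hf q hq)) p hp,
    dirDeriv_mul (F := fun q => f' (U q)) ((hf' p hp).differentiableAt.comp p (hd p hp)) hd2,
    dirDeriv_comp (hd p hp) (hf' p hp)]
  ring

/-- The wave operator of a composition sees the first derivatives of `U` only through the null form;
this is why an exponential removes the nonlinearity. -/
theorem waveOp_comp {U : E3 × ℝ → ℝ} {D : Set (E3 × ℝ)} (hD : IsOpen D)
    (hU : ContDiffOn ℝ 2 U D) {f f' f'' : ℝ → ℝ} (hf : ∀ q ∈ D, HasDerivAt f (f' (U q)) (U q))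
    (hf' : ∀ q ∈ D, HasDerivAt f' (f'' (U q)) (U q)) {p : E3 × ℝ} (hp : p ∈ D) :
    waveOp (fun q => f (U q)) p = f'' (U p) * nullForm U p + f' (U p) * waveOp U p := by
  unfold waveOp nullForm
  simp only [dirDeriv_dirDeriv_comp hD hU hf hf' _ hp, Fin.sum_univ_three]
  ring

theorem waveOp_exp_neg {U : E3 × ℝ → ℝ} {D : Set (E3 × ℝ)} (hD : IsOpen D)
    (hU : ContDiffOn ℝ 2 U D) {p : E3 × ℝ} (hp : p ∈ D) (h : waveOp U p = nullForm U p) :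
    waveOp (fun q => Real.exp (-U q)) p = 0 := by
  have h1 : ∀ s : ℝ, HasDerivAt (fun s => Real.exp (-s)) (-Real.exp (-s)) s := fun s => by
    simpa using (hasDerivAt_neg s).exp
  rw [waveOp_comp hD hU (f := fun s => Real.exp (-s)) (f' := fun s => -Real.exp (-s))
    (f'' := fun s => Real.exp (-s)) (fun q _ => h1 _)
    (fun q _ => by simpa using (h1 (U q)).fun_neg) hp, h]
  ring

theorem waveOp_neg_log {V : E3 × ℝ → ℝ} {D : Set (E3 × ℝ)} (hD : IsOpen D)
    (hV : ContDiffOn ℝ 2 V D) (hpos : ∀ q ∈ D, 0 < V q) {p : E3 × ℝ} (hp : p ∈ D)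
    (h : waveOp V p = 0) :
    waveOp (fun q => -Real.log (V q)) p = nullForm (fun q => -Real.log (V q)) p := by
  have h1 : ∀ q ∈ D, HasDerivAt (fun s => -Real.log s) (-(V q)⁻¹) (V q) := fun q hq =>
    (Real.hasDerivAt_log (hpos q hq).ne').neg
  have h2 : ∀ q ∈ D, HasDerivAt (fun s : ℝ => -s⁻¹) ((V q ^ 2)⁻¹) (V q) := fun q hq => by
    simpa using (hasDerivAt_inv (hpos q hq).ne').fun_neg
  rw [waveOp_comp hD hV (f := fun s => -Real.log s) (f' := fun s => -s⁻¹)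
    (f'' := fun s => (s ^ 2)⁻¹) h1 h2 hp, h]
  have hd := (hV.differentiableOn (by norm_num)).differentiableAt (hD.mem_nhds hp)
  unfold nullForm
  simp only [dirDeriv_comp (f := fun s => -Real.log s) hd (h1 p hp), Fin.sum_univ_three]
  ring

/-! ### Weighted energy estimate in a light cone. -/

theorem hasDerivAt_max_zero_sq (u : ℝ) :
    HasDerivAt (fun u : ℝ => max 0 u ^ 2) (2 * max 0 u) u := by
  rcases lt_trichotomy u 0 with h | h | h
  · rw [max_eq_left h.le, mul_zero]
    refine (hasDerivAt_const u (0 : ℝ)).congr_of_eventuallyEq ?_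
    filter_upwards [Iio_mem_nhds h] with w hw
    simp [max_eq_left (mem_Iio.1 hw).le]
  · subst h
    rw [max_self, mul_zero, hasDerivAt_iff_isLittleO]
    simp only [max_self, sub_zero, smul_zero, ne_eq, OfNat.ofNat_ne_zero, not_false_eq_true,
      zero_pow]
    refine Asymptotics.IsBigO.trans_isLittleO (g := fun u : ℝ => u ^ 2) ?_ ?_
    · refine Asymptotics.IsBigO.of_bound 1 (Eventually.of_forall fun w => ?_)
      rw [one_mul, Real.norm_of_nonneg (sq_nonneg _), Real.norm_of_nonneg (sq_nonneg _)]
      rcases le_total w 0 with hw | hw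
      · rw [max_eq_left hw]; simpa using sq_nonneg w
      · rw [max_eq_right hw]
    · simpa using Asymptotics.isLittleO_pow_id (𝕜 := ℝ) (n := 2) (by norm_num)
  · rw [max_eq_right h.le]
    refine HasDerivAt.congr_of_eventuallyEq (by simpa using hasDerivAt_pow 2 u) ?_
    filter_upwards [Ioi_mem_nhds h] with w hw
    rw [max_eq_right (mem_Ioi.1 hw).le]

theorem contDiff_max_zero_sq : ContDiff ℝ 1 (fun u : ℝ => max 0 u ^ 2) := by
  rw [contDiff_one_iff_deriv]
  refine ⟨fun u => (hasDerivAt_max_zero_sq u).differentiableAt, ?_⟩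
  rw [funext fun u => (hasDerivAt_max_zero_sq u).deriv]
  fun_prop

theorem integral_fderiv_apply_eq_zero {f : E3 → ℝ} (hf : ContDiff ℝ 1 f)
    (hs : HasCompactSupport f) (v : E3) : ∫ y, fderiv ℝ f y v = 0 := by
  have hc : Continuous fun y => fderiv ℝ f y v :=
    (hf.continuous_fderiv one_ne_zero).clm_apply continuous_const
  have hs' : HasCompactSupport fun y => fderiv ℝ f y v := hs.fderiv_apply ℝ v
  have h := integral_mul_fderiv_eq_neg_fderiv_mul_of_integrable (𝕜 := ℝ) (μ := (volume : Measure E3))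
    (f := f) (g := fun _ => (1 : ℝ)) (v := v)
    (by simpa using hc.integrable_of_hasCompactSupport hs') (by simp)
    (by simpa using hf.continuous.integrable_of_hasCompactSupport hs)
    (fun x _ => hf.differentiable one_ne_zero x) (fun x _ => by fun_prop)
  simpa using h

/-- The solid backward light cone with vertex `(x₀, T)`, down to time `0`. -/
def solidCone (x₀ : E3) (T : ℝ) : Set (E3 × ℝ) :=
  {p | 0 ≤ p.2 ∧ p.2 ≤ T ∧ ‖p.1 - x₀‖ ≤ T - p.2}

theorem isCompact_solidCone (x₀ : E3) (T : ℝ) : IsCompact (solidCone x₀ T) := by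
  refine ((isCompact_closedBall x₀ T).prod (isCompact_Icc (a := (0 : ℝ)) (b := T))).of_isClosed_subset
    ?_ ?_
  · exact (isClosed_le continuous_const continuous_snd).inter
      ((isClosed_le continuous_snd continuous_const).inter
        (isClosed_le (f := fun p : E3 × ℝ => ‖p.1 - x₀‖) (g := fun p => T - p.2)
          (by fun_prop) (by fun_prop)))
  · rintro ⟨y, s⟩ ⟨h1, h2, h3⟩
    refine ⟨?_, h1, h2⟩
    rw [mem_closedBall_iff_norm]
    simp only at h1 h3
    linarith

/-- The quadratic function cutting out the cone. -/
noncomputable def coneQuad (x₀ : E3) (T : ℝ) (p : E3 × ℝ) : ℝ := (T - p.2) ^ 2 - ‖p.1 - x₀‖ ^ 2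

/-- A `C¹` weight supported in the cone. -/
noncomputable def coneWeight (x₀ : E3) (T : ℝ) (p : E3 × ℝ) : ℝ := max 0 (coneQuad x₀ T p) ^ 2

theorem mem_solidCone_of_coneQuad_pos {x₀ : E3} {T : ℝ} {p : E3 × ℝ} (h0 : 0 ≤ p.2) (hT : p.2 ≤ T)
    (h : 0 < coneQuad x₀ T p) : p ∈ solidCone x₀ T :=
  ⟨h0, hT, abs_le_of_sq_le_sq' (by unfold coneQuad at h; linarith) (by linarith) |>.2⟩

theorem contDiff_coneQuad (x₀ : E3) (T : ℝ) : ContDiff ℝ 1 (coneQuad x₀ T) := by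
  unfold coneQuad
  exact (by fun_prop : ContDiff ℝ 1 fun p : E3 × ℝ => (T - p.2) ^ 2).sub
    ((contDiff_fst.sub contDiff_const).norm_sq ℝ)

theorem contDiff_coneWeight (x₀ : E3) (T : ℝ) : ContDiff ℝ 1 (coneWeight x₀ T) :=
  contDiff_max_zero_sq.comp (contDiff_coneQuad x₀ T)

theorem hasFDerivAt_coneQuad (x₀ : E3) (T : ℝ) (p : E3 × ℝ) :
    HasFDerivAt (coneQuad x₀ T) ((-(2 * (T - p.2))) • ContinuousLinearMap.snd ℝ E3 ℝ
      - (2 : ℝ) • (innerSL ℝ (p.1 - x₀)).comp (ContinuousLinearMap.fst ℝ E3 ℝ)) p := by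
  have h1 : HasFDerivAt (fun p : E3 × ℝ => T - p.2) (-ContinuousLinearMap.snd ℝ E3 ℝ) p :=
    hasFDerivAt_snd.const_sub T
  have h2 : HasFDerivAt (fun p : E3 × ℝ => p.1 - x₀) (ContinuousLinearMap.fst ℝ E3 ℝ) p :=
    hasFDerivAt_fst.sub_const x₀
  refine ((h1.pow 2).sub h2.norm_sq).congr_fderiv ?_
  ext <;> simp

theorem dirDeriv_time_coneWeight (x₀ : E3) (T : ℝ) (p : E3 × ℝ) :
    dirDeriv timeDir (coneWeight x₀ T) p = -(4 * max 0 (coneQuad x₀ T p) * (T - p.2)) := by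
  unfold coneWeight
  rw [dirDeriv_comp (f := fun u => max 0 u ^ 2) ((hasFDerivAt_coneQuad x₀ T p).differentiableAt)
    (hasDerivAt_max_zero_sq _), dirDeriv, (hasFDerivAt_coneQuad x₀ T p).fderiv]
  simp [timeDir]; ring

theorem dirDeriv_space_coneWeight (x₀ : E3) (T : ℝ) (p : E3 × ℝ) (i : Fin 3) :
    dirDeriv (spaceDir i) (coneWeight x₀ T) p
      = -(4 * max 0 (coneQuad x₀ T p) * (p.1 - x₀) i) := by
  unfold coneWeight
  rw [dirDeriv_comp (f := fun u => max 0 u ^ 2) ((hasFDerivAt_coneQuad x₀ T p).differentiableAt)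
    (hasDerivAt_max_zero_sq _), dirDeriv, (hasFDerivAt_coneQuad x₀ T p).fderiv]
  simp [spaceDir, EuclideanSpace.inner_single_right]; ring

theorem contDiff_dirDeriv {F : E3 × ℝ → ℝ} {m n : WithTop ℕ∞}
    (hF : ContDiff ℝ n F) (hmn : m + 1 ≤ n) (a : E3 × ℝ) : ContDiff ℝ m (dirDeriv a F) :=
  (hF.fderiv_right hmn).clm_apply contDiff_const

theorem dirDeriv_comm {F : E3 × ℝ → ℝ} (hF : ContDiff ℝ 2 F) (a b p : E3 × ℝ) :
    dirDeriv a (dirDeriv b F) p = dirDeriv b (dirDeriv a F) p := by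
  have hd : DifferentiableAt ℝ (fderiv ℝ F) p :=
    (hF.fderiv_right (m := 1) (by norm_num)).differentiable one_ne_zero p
  have h : ∀ c d : E3 × ℝ, dirDeriv c (dirDeriv d F) p = fderiv ℝ (fderiv ℝ F) p c d := by
    intro c d
    unfold dirDeriv
    rw [fderiv_clm_apply hd (by fun_prop)]
    simp
  rw [h, h]
  exact (hF.contDiffAt.isSymmSndFDerivAt (by simp)).eq a b

theorem dirDeriv_add {F G : E3 × ℝ → ℝ} {p a : E3 × ℝ}
    (hF : DifferentiableAt ℝ F p) (hG : DifferentiableAt ℝ G p) :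
    dirDeriv a (fun q => F q + G q) p = dirDeriv a F p + dirDeriv a G p := by
  unfold dirDeriv
  rw [fderiv_fun_add hF hG]; rfl

theorem dirDeriv_sum {F : Fin 3 → E3 × ℝ → ℝ} {p a : E3 × ℝ}
    (hF : ∀ i, DifferentiableAt ℝ (F i) p) :
    dirDeriv a (fun q => ∑ i, F i q) p = ∑ i, dirDeriv a (F i) p := by
  unfold dirDeriv
  rw [fderiv_fun_sum fun i _ => hF i, _root_.sum_apply]

section Energy

variable (x₀ : E3) (T : ℝ) (Z : E3 × ℝ → ℝ)

/-- Weighted energy density. -/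
noncomputable def weightedEnergy (p : E3 × ℝ) : ℝ :=
  coneWeight x₀ T p * (dirDeriv timeDir Z p * dirDeriv timeDir Z p
    + ∑ i, dirDeriv (spaceDir i) Z p * dirDeriv (spaceDir i) Z p)

/-- Weighted energy flux. -/
noncomputable def weightedFlux (i : Fin 3) (p : E3 × ℝ) : ℝ :=
  coneWeight x₀ T p * (dirDeriv timeDir Z p * dirDeriv (spaceDir i) Z p)

/-- Space-time divergence of the weighted energy current. -/
noncomputable def energyDiv (p : E3 × ℝ) : ℝ :=
  dirDeriv timeDir (weightedEnergy x₀ T Z) p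
    - 2 * ∑ i, dirDeriv (spaceDir i) (weightedFlux x₀ T Z i) p

variable {x₀ T Z}

theorem contDiff_weightedEnergy (hZ : ContDiff ℝ 2 Z) : ContDiff ℝ 1 (weightedEnergy x₀ T Z) := by
  have h := fun a => contDiff_dirDeriv (m := 1) hZ (by norm_num) a
  exact (contDiff_coneWeight x₀ T).mul (((h _).mul (h _)).add
    (ContDiff.sum fun i _ => (h _).mul (h _)))

theorem contDiff_weightedFlux (hZ : ContDiff ℝ 2 Z) (i : Fin 3) :
    ContDiff ℝ 1 (weightedFlux x₀ T Z i) := by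
  have h := fun a => contDiff_dirDeriv (m := 1) hZ (by norm_num) a
  exact (contDiff_coneWeight x₀ T).mul ((h _).mul (h _))

theorem continuous_energyDiv (hZ : ContDiff ℝ 2 Z) : Continuous (energyDiv x₀ T Z) :=
  (contDiff_dirDeriv (m := 0) (contDiff_weightedEnergy hZ) (by norm_num) _).continuous.sub
    (continuous_const.mul (continuous_finsetSum _ fun i _ =>
      (contDiff_dirDeriv (m := 0) (contDiff_weightedFlux hZ i) (by norm_num) _).continuous))

/-- The usual energy identity plus the terms where the weight is differentiated. The `C¹` weight
vanishes on the lateral boundary, so only a cylinder has to be integrated over, never a cone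
boundary. -/
theorem energyDiv_eq (hZ : ContDiff ℝ 2 Z) (p : E3 × ℝ) :
    energyDiv x₀ T Z p =
      4 * max 0 (coneQuad x₀ T p) * (-((T - p.2) * (dirDeriv timeDir Z p ^ 2
          + ∑ i, dirDeriv (spaceDir i) Z p ^ 2))
        + 2 * dirDeriv timeDir Z p * ∑ i, (p.1 - x₀) i * dirDeriv (spaceDir i) Z p)
      + 2 * coneWeight x₀ T p * dirDeriv timeDir Z p * waveOp Z p := by
  have hd := fun a => (contDiff_dirDeriv (m := 1) hZ (by norm_num) a).differentiable one_ne_zero p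
  have hη := (contDiff_coneWeight x₀ T).differentiable one_ne_zero p
  have hsum : ∀ a, dirDeriv a (fun p => ∑ i, dirDeriv (spaceDir i) Z p * dirDeriv (spaceDir i) Z p) p
      = ∑ i, 2 * (dirDeriv (spaceDir i) Z p * dirDeriv a (dirDeriv (spaceDir i) Z) p) := by
    intro a
    rw [dirDeriv_sum (F := fun i p => dirDeriv (spaceDir i) Z p * dirDeriv (spaceDir i) Z p)
      fun i => (hd _).mul (hd _)]
    refine Finset.sum_congr rfl fun i _ => ?_
    rw [dirDeriv_mul (hd _) (hd _)]; ring
  unfold energyDiv waveOp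
  have h1 : dirDeriv timeDir (weightedEnergy x₀ T Z) p = _ :=
    dirDeriv_mul (G := fun p => dirDeriv timeDir Z p * dirDeriv timeDir Z p
      + ∑ i, dirDeriv (spaceDir i) Z p * dirDeriv (spaceDir i) Z p) hη
      (((hd _).mul (hd _)).add (DifferentiableAt.fun_sum fun i _ => (hd _).mul (hd _)))
  have h2 : ∀ i, dirDeriv (spaceDir i) (weightedFlux x₀ T Z i) p = _ := fun i =>
    dirDeriv_mul (G := fun p => dirDeriv timeDir Z p * dirDeriv (spaceDir i) Z p) hη
      ((hd _).mul (hd _))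
  have h3 : dirDeriv timeDir (fun p => dirDeriv timeDir Z p * dirDeriv timeDir Z p
      + ∑ i, dirDeriv (spaceDir i) Z p * dirDeriv (spaceDir i) Z p) p
      = 2 * (dirDeriv timeDir Z p * dirDeriv timeDir (dirDeriv timeDir Z) p)
        + ∑ i, 2 * (dirDeriv (spaceDir i) Z p *
          dirDeriv (spaceDir i) (dirDeriv timeDir Z) p) := by
    rw [dirDeriv_add (F := fun p => dirDeriv timeDir Z p * dirDeriv timeDir Z p)
      (G := fun p => ∑ i, dirDeriv (spaceDir i) Z p * dirDeriv (spaceDir i) Z p)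
      ((hd _).mul (hd _)) (DifferentiableAt.fun_sum fun i _ => (hd _).mul (hd _))]
    rw [hsum, dirDeriv_mul (hd _) (hd _)]
    simp only [dirDeriv_comm hZ timeDir (spaceDir _)]
    ring
  rw [h1, h3]
  simp only [h2, dirDeriv_mul (hd _) (hd _), dirDeriv_time_coneWeight, dirDeriv_space_coneWeight,
    Fin.sum_univ_three]
  ring

theorem coneWeight_eq_zero {p : E3 × ℝ} (h : coneQuad x₀ T p ≤ 0) : coneWeight x₀ T p = 0 := by
  simp [coneWeight, max_eq_left h]

theorem energyDiv_nonpos (hZ : ContDiff ℝ 2 Z) (hw : ∀ p ∈ solidCone x₀ T, waveOp Z p = 0)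
    {p : E3 × ℝ} (h0 : 0 ≤ p.2) (hT : p.2 ≤ T) : energyDiv x₀ T Z p ≤ 0 := by
  rw [energyDiv_eq hZ]
  rcases le_or_gt (coneQuad x₀ T p) 0 with h | h
  · rw [coneWeight_eq_zero h, max_eq_left h]; simp
  · rw [hw p (mem_solidCone_of_coneQuad_pos h0 hT h), max_eq_right h.le]
    have hd : 0 < T - p.2 := by
      rcases (sub_nonneg.2 hT).eq_or_lt with h' | h'
      · unfold coneQuad at h
        rw [← h'] at h
        nlinarith [sq_nonneg ‖p.1 - x₀‖]
      · exact h'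
    have hn : ‖p.1 - x₀‖ ^ 2 = ∑ i, (p.1 - x₀) i ^ 2 := by
      rw [EuclideanSpace.norm_sq_eq]; simp
    have hq := h
    unfold coneQuad at hq
    rw [hn] at hq
    simp only [Fin.sum_univ_three] at hq ⊢
    rw [mul_zero, add_zero]
    refine mul_nonpos_of_nonneg_of_nonpos (by positivity) ?_
    -- With d = T - t, a = Z_t, b = ∇Z and w = x - x₀, multiplication by d turns the bracket into
    -- -|d b - a w|² - a²(d² - |w|²).
    refine nonpos_of_mul_nonpos_right ?_ hd
    set d := T - p.2
    set a := dirDeriv timeDir Z p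
    set w := p.1 - x₀
    nlinarith [sq_nonneg (d * dirDeriv (spaceDir 0) Z p - a * w 0),
      sq_nonneg (d * dirDeriv (spaceDir 1) Z p - a * w 1),
      sq_nonneg (d * dirDeriv (spaceDir 2) Z p - a * w 2),
      mul_nonneg hq.le (sq_nonneg a)]

/-- The time part telescopes between t = T, where the weight vanishes, and t = 0, where the data
vanish; the flux part is the integral of a derivative of a compactly supported function. -/
theorem integral_energyDiv_eq_zero (hT : 0 ≤ T) (hZ : ContDiff ℝ 2 Z)
    (h0 : ∀ y, ‖y - x₀‖ ≤ T → Z (y, 0) = 0)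
    (h1 : ∀ y, ‖y - x₀‖ ≤ T → dirDeriv timeDir Z (y, 0) = 0) :
    ∫ p in Metric.closedBall x₀ T ×ˢ Icc 0 T, energyDiv x₀ T Z p = 0 := by
  have hK : IsCompact (Metric.closedBall x₀ T ×ˢ Icc 0 T) :=
    (isCompact_closedBall x₀ T).prod isCompact_Icc
  have hEc : Continuous (dirDeriv timeDir (weightedEnergy x₀ T Z)) :=
    (contDiff_dirDeriv (m := 0) (contDiff_weightedEnergy hZ) (by norm_num) _).continuous
  have hBc : ∀ i, Continuous (dirDeriv (spaceDir i) (weightedFlux x₀ T Z i)) := fun i =>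
    (contDiff_dirDeriv (m := 0) (contDiff_weightedFlux hZ i) (by norm_num) _).continuous
  have hE : ∫ p in Metric.closedBall x₀ T ×ˢ Icc 0 T,
      dirDeriv timeDir (weightedEnergy x₀ T Z) p = 0 := by
    rw [Measure.volume_eq_prod, setIntegral_prod _ (hEc.continuousOn.integrableOn_compact hK)]
    refine setIntegral_eq_zero_of_forall_eq_zero fun y hy => ?_
    rw [integral_Icc_eq_integral_Ioc, ← intervalIntegral.integral_of_le hT]
    have hder : ∀ s ∈ uIcc 0 T, HasDerivAt (fun s => weightedEnergy x₀ T Z (y, s))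
        (dirDeriv timeDir (weightedEnergy x₀ T Z) (y, s)) s := fun s _ =>
      ((contDiff_weightedEnergy hZ).differentiable one_ne_zero (y, s)).hasFDerivAt.comp_hasDerivAt s
        ((hasDerivAt_const s y).prodMk (hasDerivAt_id s))
    rw [intervalIntegral.integral_eq_sub_of_hasDerivAt hder
      ((hEc.comp (Continuous.prodMk_right y)).intervalIntegrable _ _)]
    have hend : weightedEnergy x₀ T Z (y, T) = 0 := by
      unfold weightedEnergy
      rw [coneWeight_eq_zero (by simp [coneQuad]), zero_mul]
    have hbeg : weightedEnergy x₀ T Z (y, 0) = 0 := by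
      unfold weightedEnergy
      -- On and beyond the rim the weight is zero. Inside, Z(·,0) vanishes in a neighbourhood, so
      -- its spatial derivatives vanish too.
      rcases le_or_gt T ‖y - x₀‖ with hle | hlt
      · rw [coneWeight_eq_zero, zero_mul]
        have := pow_le_pow_left₀ hT hle 2
        simpa [coneQuad] using this
      · have hz : (fun y' => Z (y', 0)) =ᶠ[𝓝 y] fun _ => 0 := by
          have : Metric.ball x₀ T ∈ 𝓝 y := Metric.isOpen_ball.mem_nhds (mem_ball_iff_norm.2 hlt)
          filter_upwards [this] with y' hy'
          exact h0 y' (mem_ball_iff_norm.1 hy').le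
        have hs : ∀ i, dirDeriv (spaceDir i) Z (y, 0) = 0 := fun i => by
          rw [← fderiv_slice_eq (hZ.differentiable (by norm_num) _), hz.fderiv_eq]
          simp
        simp [hs, h1 y hlt.le]
    rw [hend, hbeg, sub_zero]
  have hB : ∀ i, ∫ p in Metric.closedBall x₀ T ×ˢ Icc 0 T,
      dirDeriv (spaceDir i) (weightedFlux x₀ T Z i) p = 0 := by
    intro i
    have hint : IntegrableOn (dirDeriv (spaceDir i) (weightedFlux x₀ T Z i))
      (Metric.closedBall x₀ T ×ˢ Icc 0 T) (volume.prod volume) :=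
      (hBc i).continuousOn.integrableOn_compact hK
    rw [Measure.volume_eq_prod, ← setIntegral_prod_swap,
      setIntegral_prod (fun z : ℝ × E3 => dirDeriv (spaceDir i) (weightedFlux x₀ T Z i) z.swap)
        hint.swap]
    refine setIntegral_eq_zero_of_forall_eq_zero fun s hs => ?_
    have hzero : ∀ y, T ≤ ‖y - x₀‖ → weightedFlux x₀ T Z i (y, s) = 0 := fun y hy => by
      unfold weightedFlux
      rw [coneWeight_eq_zero, zero_mul]
      have := pow_le_pow_left₀ (by linarith [hs.2]) (by linarith [hs.1] : T - s ≤ ‖y - x₀‖) 2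
      simpa [coneQuad] using this
    have hfd : ∀ y, dirDeriv (spaceDir i) (weightedFlux x₀ T Z i) (y, s)
        = fderiv ℝ (fun y => weightedFlux x₀ T Z i (y, s)) y (EuclideanSpace.single i 1) := fun y =>
      (fderiv_slice_eq ((contDiff_weightedFlux hZ i).differentiable one_ne_zero _) i).symm
    simp only [Prod.swap, hfd]
    rw [setIntegral_eq_integral_of_forall_compl_eq_zero]
    · refine integral_fderiv_apply_eq_zero
        ((contDiff_weightedFlux hZ i).comp (by fun_prop)) ?_ _
      refine HasCompactSupport.intro (isCompact_closedBall x₀ T) fun y hy => hzero y ?_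
      rw [mem_closedBall_iff_norm] at hy
      linarith
    · intro y hy
      rw [mem_closedBall_iff_norm, not_le] at hy
      have : (fun y => weightedFlux x₀ T Z i (y, s)) =ᶠ[𝓝 y] fun _ => 0 := by
        filter_upwards [(isOpen_lt continuous_const
          (by fun_prop : Continuous fun y : E3 => ‖y - x₀‖)).mem_nhds hy] with z hz
        exact hzero z (le_of_lt hz)
      rw [this.fderiv_eq]; simp
  unfold energyDiv
  rw [integral_sub (hEc.continuousOn.integrableOn_compact hK), hE, integral_const_mul,
    integral_finsetSum]
  · simp [hB]
  · exact fun i _ => (hBc i).continuousOn.integrableOn_compact hK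
  · exact (continuous_const.mul (continuous_finsetSum _ fun i _ =>
      hBc i)).continuousOn.integrableOn_compact hK

/-- A nonpositive continuous divergence with integral zero vanishes. On the axis of the cone it is a
negative multiple of Z_t² + |∇Z|², so Z is constant along the axis up to the vertex. -/
theorem eq_zero_at_vertex_of_contDiff (hT : 0 < T) (hZ : ContDiff ℝ 2 Z)
    (hw : ∀ p ∈ solidCone x₀ T, waveOp Z p = 0)
    (h0 : ∀ y, ‖y - x₀‖ ≤ T → Z (y, 0) = 0)
    (h1 : ∀ y, ‖y - x₀‖ ≤ T → dirDeriv timeDir Z (y, 0) = 0) : Z (x₀, T) = 0 := by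
  have hK : IsCompact (Metric.closedBall x₀ T ×ˢ Icc 0 T) :=
    (isCompact_closedBall x₀ T).prod isCompact_Icc
  have hc := continuous_energyDiv (x₀ := x₀) (T := T) hZ
  have hint := integral_energyDiv_eq_zero hT.le hZ h0 h1
  have hae : (fun p => -energyDiv x₀ T Z p)
      =ᵐ[volume.restrict (Metric.closedBall x₀ T ×ˢ Icc 0 T)] 0 := by
    refine (setIntegral_eq_zero_iff_of_nonneg_ae ?_ ?_).1 ?_
    · refine (ae_restrict_iff' hK.measurableSet).2 (Eventually.of_forall fun p hp => ?_)
      simpa using energyDiv_nonpos hZ hw hp.2.1 hp.2.2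
    · exact hc.neg.continuousOn.integrableOn_compact hK
    · rw [integral_neg, hint, neg_zero]
  have hopen : EqOn (fun p => -energyDiv x₀ T Z p) 0 (Metric.ball x₀ T ×ˢ Ioo 0 T) :=
    Measure.eqOn_open_of_ae_eq (ae_restrict_of_ae_restrict_of_subset
      (prod_mono Metric.ball_subset_closedBall Ioo_subset_Icc_self) hae)
      (Metric.isOpen_ball.prod isOpen_Ioo) hc.neg.continuousOn continuousOn_const
  have hz : ∀ s ∈ Ioo 0 T, dirDeriv timeDir Z (x₀, s) = 0 := by
    intro s hs
    have h := hopen (x := (x₀, s)) ⟨Metric.mem_ball_self hT, hs⟩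
    have hd : 0 < T - s := sub_pos.2 hs.2
    simp only [Pi.zero_apply, neg_eq_zero] at h
    rw [energyDiv_eq hZ, hw (x₀, s) ⟨hs.1.le, hs.2.le, by simpa using hd.le⟩] at h
    simp only [coneQuad, sub_self, norm_zero, PiLp.zero_apply, zero_mul, Finset.sum_const_zero,
      mul_zero, add_zero, ne_eq, OfNat.ofNat_ne_zero, not_false_eq_true, zero_pow, sub_zero] at h
    rw [max_eq_right (by positivity)] at h
    have h2 : dirDeriv timeDir Z (x₀, s) ^ 2 + ∑ i, dirDeriv (spaceDir i) Z (x₀, s) ^ 2 = 0 := by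
      simpa [hd.ne'] using h
    have h3 : 0 ≤ ∑ i, dirDeriv (spaceDir i) Z (x₀, s) ^ 2 :=
      Finset.sum_nonneg fun i _ => sq_nonneg _
    exact pow_eq_zero_iff (two_ne_zero) |>.1 (le_antisymm (by linarith) (sq_nonneg _))
  have hdz : ∀ s, HasDerivAt (fun s => Z (x₀, s)) (dirDeriv timeDir Z (x₀, s)) s := fun s =>
    (hZ.differentiable (by norm_num) (x₀, s)).hasFDerivAt.comp_hasDerivAt s
        ((hasDerivAt_const s x₀).prodMk (hasDerivAt_id s))
  obtain ⟨s, hs, hsl⟩ := exists_hasDerivAt_eq_slope (fun s => Z (x₀, s)) _ hT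
    (fun s _ => (hdz s).continuousAt.continuousWithinAt) (fun s _ => hdz s)
  rw [hz s hs, h0 x₀ (by simpa using hT.le), eq_comm, div_eq_zero_iff] at hsl
  rcases hsl with h | h <;> linarith

end Energy

/-! ### Localisation to a cone inside an open domain. -/

/-- Multiplication by a cutoff equal to 1 near the compact set lets the energy identity, proved for
globally `C²` functions, be used on an open domain. -/
theorem exists_contDiff_eq_near {K D : Set (E3 × ℝ)} (hK : IsCompact K) (hD : IsOpen D)
    (hKD : K ⊆ D) {Z : E3 × ℝ → ℝ} (hZ : ContDiffOn ℝ 2 Z D) :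
    ∃ (Y : E3 × ℝ → ℝ) (W : Set (E3 × ℝ)), ContDiff ℝ 2 Y ∧ IsOpen W ∧ K ⊆ W ∧
      ∀ p ∈ W, Y p = Z p := by
  obtain ⟨L, hL, hKL, hLD⟩ := exists_compact_between hK hD hKD
  obtain ⟨f, hf1, hf0, -⟩ := exists_contMDiffMap_one_nhds_of_subset_interior
    (n := 2) (modelWithCornersSelf ℝ (E3 × ℝ)) hK.isClosed hKL
  have hf : ContDiff ℝ 2 f := f.contMDiff.contDiff
  obtain ⟨W, hW, hKW, hWf⟩ := (eventually_nhdsSet_iff_exists).1 hf1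
  refine ⟨fun p => f p * Z p, W, ?_, hW, hKW, fun p hp => by simp [hWf p hp]⟩
  rw [contDiff_iff_contDiffAt]
  intro p
  by_cases hp : p ∈ D
  · exact hf.contDiffAt.mul (hZ.contDiffAt (hD.mem_nhds hp))
  · have : (fun p => f p * Z p) =ᶠ[𝓝 p] fun _ => 0 := by
      filter_upwards [hL.isClosed.isOpen_compl.mem_nhds fun h => hp (hLD h)] with q hq
      rw [hf0 q hq, zero_mul]
    exact contDiffAt_const.congr_of_eventuallyEq this

theorem eq_zero_at_vertex {D : Set (E3 × ℝ)} (hD : IsOpen D) {Z : E3 × ℝ → ℝ}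
    (hZ : ContDiffOn ℝ 2 Z D) (hw : ∀ p ∈ D, waveOp Z p = 0) {x₀ : E3} {T : ℝ} (hT : 0 < T)
    (hc : solidCone x₀ T ⊆ D) (h0 : ∀ y, Z (y, 0) = 0)
    (h1 : ∀ y, (y, (0 : ℝ)) ∈ D → dirDeriv timeDir Z (y, 0) = 0) : Z (x₀, T) = 0 := by
  obtain ⟨Y, W, hY, hW, hKW, hYZ⟩ := exists_contDiff_eq_near (isCompact_solidCone x₀ T) hD hc hZ
  have hv : (x₀, T) ∈ solidCone x₀ T := ⟨hT.le, le_rfl, by simp⟩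
  have hb : ∀ y, ‖y - x₀‖ ≤ T → (y, (0 : ℝ)) ∈ solidCone x₀ T := fun y hy =>
    ⟨le_rfl, hT.le, by simpa using hy⟩
  rw [← hYZ _ (hKW hv)]
  refine eq_zero_at_vertex_of_contDiff hT hY (fun p hp => ?_) (fun y hy => ?_) fun y hy => ?_
  · rw [waveOp_congr hW hYZ p (hKW hp), hw p (hc hp)]
  · rw [hYZ _ (hKW (hb y hy)), h0]
  · rw [dirDeriv_congr hW hYZ _ (hKW (hb y hy)), h1 y (hc (hb y hy))]

/-! ### The maximal domain, uniqueness and maximality. -/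

/-- The points whose solid light cone down to time `0` lies in `{V > 0}`. -/
def positivityDomain (V : E3 × ℝ → ℝ) : Set (E3 × ℝ) :=
  {p | ∀ (y : E3) (s : ℝ), s ∈ uIcc 0 p.2 → ‖y - p.1‖ ≤ |p.2 - s| → 0 < V (y, s)}

theorem pos_of_mem_positivityDomain {V : E3 × ℝ → ℝ} {p : E3 × ℝ} (hp : p ∈ positivityDomain V) :
    0 < V p := hp p.1 p.2 right_mem_uIcc (by simp)

/-- Every solid cone is the continuous image of one fixed compact set, unit ball times [0,1], with
the vertex as parameter; positivity on a compact set is an open condition on the parameter. -/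
theorem isOpen_positivityDomain {V : E3 × ℝ → ℝ} (hV : Continuous V) :
    IsOpen (positivityDomain V) := by
  set Φ : (E3 × ℝ) → (E3 × ℝ) → E3 × ℝ := fun p k =>
    (p.1 + |p.2 - k.2 * p.2| • k.1, k.2 * p.2) with hΦ
  have hΦc : Continuous fun z : (E3 × ℝ) × (E3 × ℝ) => Φ z.1 z.2 := by simp only [hΦ]; fun_prop
  have hK : IsCompact (Metric.closedBall (0 : E3) 1 ×ˢ Icc (0 : ℝ) 1) :=
    (isCompact_closedBall _ _).prod isCompact_Icc
  have heq : positivityDomain V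
      = {p | ∀ k ∈ Metric.closedBall (0 : E3) 1 ×ˢ Icc (0 : ℝ) 1, 0 < V (Φ p k)} := by
    ext ⟨x, t⟩
    constructor
    · rintro h ⟨e, l⟩ ⟨he, hl⟩
      refine h _ _ ?_ ?_
      · rw [← segment_eq_uIcc, segment_eq_image]
        exact ⟨l, hl, by simp⟩
      · rw [mem_closedBall_zero_iff] at he
        simp only [add_sub_cancel_left, norm_smul, Real.norm_eq_abs, abs_abs]
        exact mul_le_of_le_one_right (abs_nonneg _) he
    · intro h y s hs hy
      rw [← segment_eq_uIcc, segment_eq_image] at hs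
      obtain ⟨l, hl, rfl⟩ := hs
      simp only [mul_zero, zero_add, smul_eq_mul] at hy ⊢
      have h1 := h (|t - l * t|⁻¹ • (y - x), l) ⟨?_, hl⟩
      · simp only [hΦ, smul_smul] at h1
        by_cases h0 : |t - l * t| = 0
        · rw [h0] at hy h1
          have : y = x := by simpa [sub_eq_zero] using hy
          simpa [this] using h1
        · rwa [mul_inv_cancel₀ h0, one_smul, add_sub_cancel] at h1
      · rw [mem_closedBall_zero_iff, norm_smul, norm_inv, Real.norm_eq_abs, abs_abs]
        exact inv_mul_le_one_of_le₀ hy (abs_nonneg _)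
  rw [heq, isOpen_iff_mem_nhds]
  intro p hp
  exact hK.eventually_forall_of_forall_eventually fun k hk =>
    ((hV.comp hΦc).continuousAt (x := (p, k))).eventually (lt_mem_nhds (hp k hk))

theorem lightConeClosed_positivityDomain (V : E3 × ℝ → ℝ) :
    LightConeClosed (positivityDomain V) := by
  intro x t h y s hs hy z r hr hz
  have hr' : r ∈ uIcc 0 t := uIcc_subset_uIcc left_mem_uIcc hs hr
  refine h z r hr' ?_
  have hsum : |t - s| + |s - r| = |t - r| := by
    simp only at hr
    rcases le_total 0 t with h0 | h0
    · rw [uIcc_of_le h0] at hs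
      rw [uIcc_of_le hs.1] at hr
      rw [abs_of_nonneg (by linarith [hs.2]), abs_of_nonneg (by linarith [hr.2]),
        abs_of_nonneg (by linarith [hs.2, hr.2])]
      ring
    · rw [uIcc_of_ge h0] at hs
      rw [uIcc_of_ge hs.2] at hr
      rw [abs_of_nonpos (by linarith [hs.1]), abs_of_nonpos (by linarith [hr.1]),
        abs_of_nonpos (by linarith [hs.1, hr.1])]
      ring
  have htri : ‖z - x‖ ≤ ‖z - y‖ + ‖y - x‖ := norm_sub_le_norm_sub_add_norm_sub z y x
  simp only at hz ⊢
  linarith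

/-- Time reflection of `ℝ³ × ℝ`. -/
noncomputable def timeReflection : (E3 × ℝ) ≃L[ℝ] (E3 × ℝ) :=
  (ContinuousLinearEquiv.refl ℝ E3).prodCongr (ContinuousLinearEquiv.neg ℝ)

theorem timeReflection_apply (x : E3) (t : ℝ) : timeReflection (x, t) = (x, -t) := rfl

theorem dirDeriv_comp_timeReflection (a : E3 × ℝ) (F : E3 × ℝ → ℝ) (p : E3 × ℝ) :
    dirDeriv a (fun q => F (timeReflection q)) p
      = dirDeriv (timeReflection a) F (timeReflection p) := by
  unfold dirDeriv
  rw [show (fun q => F (timeReflection q)) = F ∘ timeReflection from rfl,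
    timeReflection.comp_right_fderiv]
  rfl

theorem timeReflection_timeDir : timeReflection timeDir = -timeDir := by
  simp [timeDir, timeReflection_apply]

theorem timeReflection_spaceDir (i : Fin 3) : timeReflection (spaceDir i) = spaceDir i := by
  simp [spaceDir, timeReflection_apply]

theorem dirDeriv_neg_dir (a : E3 × ℝ) (F : E3 × ℝ → ℝ) : dirDeriv (-a) F = -dirDeriv a F := by
  funext p; simp [dirDeriv]

theorem dirDeriv_neg (a : E3 × ℝ) (F : E3 × ℝ → ℝ) (p : E3 × ℝ) :
    dirDeriv a (-F) p = -dirDeriv a F p := by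
  rw [dirDeriv, fderiv_neg]; rfl

theorem waveOp_comp_timeReflection (F : E3 × ℝ → ℝ) (p : E3 × ℝ) :
    waveOp (fun q => F (timeReflection q)) p = waveOp F (timeReflection p) := by
  have h : ∀ a, dirDeriv a (dirDeriv a fun q => F (timeReflection q)) p
      = dirDeriv (timeReflection a) (dirDeriv (timeReflection a) F) (timeReflection p) := by
    intro a
    rw [funext fun q => dirDeriv_comp_timeReflection a F q, dirDeriv_comp_timeReflection]
  unfold waveOp
  simp only [h, timeReflection_timeDir, timeReflection_spaceDir, dirDeriv_neg_dir, Pi.neg_apply,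
    dirDeriv_neg, neg_neg]

/-- Negative times reduce to positive ones by time reflection, which preserves the wave operator. -/
theorem eq_zero_of_wave {D : Set (E3 × ℝ)} (hD : IsOpen D) (hc : LightConeClosed D)
    {Z : E3 × ℝ → ℝ} (hZ : ContDiffOn ℝ 2 Z D) (hw : ∀ p ∈ D, waveOp Z p = 0)
    (h0 : ∀ y, Z (y, 0) = 0) (h1 : ∀ y, (y, (0 : ℝ)) ∈ D → dirDeriv timeDir Z (y, 0) = 0)
    {x : E3} {t : ℝ} (hx : (x, t) ∈ D) : Z (x, t) = 0 := by
  rcases lt_trichotomy t 0 with ht | ht | ht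
  · have h := eq_zero_at_vertex (D := timeReflection ⁻¹' D) (Z := fun q => Z (timeReflection q))
      (hD.preimage timeReflection.continuous)
      (hZ.comp timeReflection.contDiff.contDiffOn fun _ h => h)
      (fun p hp => by rw [waveOp_comp_timeReflection, hw _ hp]) (x₀ := x) (T := -t) (by linarith)
      ?_ (fun y => by simp [timeReflection_apply, h0]) (fun y hy => ?_)
    · simpa [timeReflection_apply] using h
    · rintro ⟨y, s⟩ ⟨hs0, hs1, hy⟩
      refine hc x t hx y (-s) ?_ (hy.trans ?_)
      · rw [uIcc_of_ge ht.le]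
        constructor <;> simp only at hs0 hs1 <;> linarith
      · exact (le_abs_self _).trans_eq (by rw [← abs_neg]; congr 1; simp; ring)
    · rw [dirDeriv_comp_timeReflection, timeReflection_timeDir, dirDeriv_neg_dir]
      simp only [mem_preimage, timeReflection_apply, neg_zero] at hy
      simp [timeReflection_apply, h1 y hy]
  · rw [ht, h0]
  · refine eq_zero_at_vertex hD hZ hw ht ?_ h0 h1
    rintro ⟨y, s⟩ ⟨hs0, hs1, hy⟩
    refine hc x t hx y s ?_ (hy.trans (le_abs_self _))
    rw [uIcc_of_le ht.le]
    exact ⟨hs0, hs1⟩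

theorem dirDeriv_sub {F G : E3 × ℝ → ℝ} {p a : E3 × ℝ}
    (hF : DifferentiableAt ℝ F p) (hG : DifferentiableAt ℝ G p) :
    dirDeriv a (fun q => F q - G q) p = dirDeriv a F p - dirDeriv a G p := by
  unfold dirDeriv
  rw [fderiv_fun_sub hF hG]; rfl

theorem waveOp_sub {D : Set (E3 × ℝ)} (hD : IsOpen D) {F G : E3 × ℝ → ℝ}
    (hF : ContDiffOn ℝ 2 F D) (hG : ContDiffOn ℝ 2 G D) {p : E3 × ℝ} (hp : p ∈ D) :
    waveOp (fun q => F q - G q) p = waveOp F p - waveOp G p := by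
  have hd : ∀ {H : E3 × ℝ → ℝ}, ContDiffOn ℝ 2 H D → ∀ q ∈ D, DifferentiableAt ℝ H q :=
    fun h q hq => (h.differentiableOn (by norm_num)).differentiableAt (hD.mem_nhds hq)
  have hd' : ∀ {H : E3 × ℝ → ℝ}, ContDiffOn ℝ 2 H D → ∀ a, DifferentiableAt ℝ (dirDeriv a H) p :=
    fun h a => ((h.dirDeriv hD (m := 1) (by norm_num) a).differentiableOn
      one_ne_zero).differentiableAt (hD.mem_nhds hp)
  have h : ∀ a, dirDeriv a (dirDeriv a fun q => F q - G q) p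
      = dirDeriv a (dirDeriv a F) p - dirDeriv a (dirDeriv a G) p := fun a => by
    rw [dirDeriv_congr hD (fun q hq => dirDeriv_sub (hd hF q hq) (hd hG q hq)) p hp,
      dirDeriv_sub (hd' hF a) (hd' hG a)]
  unfold waveOp
  simp only [h, Finset.sum_sub_distrib]
  ring

theorem contDiffOn_neg_log {V : E3 × ℝ → ℝ} (hV : ContDiff ℝ ∞ V) :
    ContDiffOn ℝ ∞ (fun p => -Real.log (V p)) (positivityDomain V) :=
  (hV.contDiffOn.log fun _ hp => (pos_of_mem_positivityDomain hp).ne').neg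

theorem isMaximalSolution_neg_log {u₀ u₁ : E3 → ℝ} {V : E3 × ℝ → ℝ} (hV : ContDiff ℝ ∞ V)
    (hw : ∀ p, waveOp V p = 0) (h0 : ∀ x, V (x, 0) = Real.exp (-u₀ x))
    (h1 : ∀ x, dirDeriv timeDir V (x, 0) = -u₁ x * Real.exp (-u₀ x)) :
    IsMaximalSolution u₀ u₁ (positivityDomain V) (fun x t => -Real.log (V (x, t))) := by
  have hD := isOpen_positivityDomain hV.continuous
  have hV2 : ContDiff ℝ 2 V := contDiff_infty.1 hV 2
  have hVd : Differentiable ℝ V := hV2.differentiable (by norm_num)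
  have hU := contDiffOn_neg_log hV
  have hU2 : ContDiffOn ℝ 2 (fun p => -Real.log (V p)) (positivityDomain V) :=
    contDiffOn_infty.1 hU 2
  have hinit : ∀ x : E3, (x, (0 : ℝ)) ∈ positivityDomain V := by
    intro x y s hs _
    simp only [uIcc_self, mem_singleton_iff] at hs
    rw [hs, h0]
    exact Real.exp_pos _
  refine ⟨⟨hD, hinit, lightConeClosed_positivityDomain V, hU2, ?_, ?_, ?_⟩, ?_⟩
  · intro x t hp
    exact (equation_iff_waveOp_eq_nullForm hD hU2 hp).2 (waveOp_neg_log hD hV2.contDiffOn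
      (fun q hq => pos_of_mem_positivityDomain hq) hp (hw _))
  · intro x
    simp [h0]
  · intro x
    have hd := (hU2.differentiableOn (by norm_num)).differentiableAt (hD.mem_nhds (hinit x))
    have hx : V (x, 0) ≠ 0 := by rw [h0]; exact (Real.exp_pos _).ne'
    rw [deriv_time_eq (U := fun p => -Real.log (V p)) hd,
      dirDeriv_comp (f := fun s => -Real.log s) (hVd _) (Real.hasDerivAt_log hx).neg, h1, h0]
    have := (Real.exp_pos (-u₀ x)).ne'
    field_simp
  -- The function exp(-u') has the same Cauchy data as `V` and solves the same linear equation. So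
  -- `V` is positive on `D'`, and on all light cones from its points.
  · intro D' u' h'
    have hU' : ContDiffOn ℝ 2 (fun p : E3 × ℝ => Real.exp (-u' p.1 p.2)) D' :=
      h'.contDiffOn.neg.exp
    have key : ∀ (x : E3) (t : ℝ), (x, t) ∈ D' → Real.exp (-u' x t) = V (x, t) := by
      intro x t hp
      have := eq_zero_of_wave h'.isOpen h'.lightConeClosed
        (Z := fun p => Real.exp (-u' p.1 p.2) - V p) (hU'.sub hV2.contDiffOn) (fun p hp => ?_)
        (fun y => ?_) (fun y hy => ?_) hp
      · exact sub_eq_zero.1 this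
      · rw [waveOp_sub h'.isOpen hU' hV2.contDiffOn hp, hw, sub_zero]
        exact waveOp_exp_neg (U := fun p => u' p.1 p.2) h'.isOpen h'.contDiffOn hp
          ((equation_iff_waveOp_eq_nullForm (U := fun p => u' p.1 p.2) h'.isOpen h'.contDiffOn hp).1
            (h'.equation p.1 p.2 hp))
      · simp [h'.initial_value, h0]
      · have hd := (h'.contDiffOn.differentiableOn (by norm_num)).differentiableAt
          (h'.isOpen.mem_nhds hy)
        have hd' := (hU'.differentiableOn (by norm_num)).differentiableAt (h'.isOpen.mem_nhds hy)
        have he : HasDerivAt (fun s => Real.exp (-s)) (-Real.exp (-u' y 0)) (u' y 0) := by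
          simpa using (hasDerivAt_neg (u' y 0)).exp
        rw [dirDeriv_sub hd' (hVd _), h1,
          dirDeriv_comp (U := fun p => u' p.1 p.2) (f := fun s => Real.exp (-s)) hd he,
          ← deriv_time_eq (U := fun p => u' p.1 p.2) hd, h'.initial_velocity, h'.initial_value]
        ring
    constructor
    · rintro ⟨x, t⟩ hp y s hs hy
      rw [← key y s (h'.lightConeClosed x t hp y s hs hy)]
      exact Real.exp_pos _
    · intro x t hp
      simp only
      rw [← key x t hp, Real.log_exp, neg_neg]

/-! ### Positivity near the first zero on the axis. -/

theorem radialMean_zero_pos_iff {p : ℝ → ℝ} (hp : Continuous p) {y : E3} (hy : y ≠ 0) (s : ℝ) :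
    0 < radialMean 0 p (y, s) ↔
      (∫ τ in (0 : ℝ)..(s - ‖y‖), p τ) < ∫ τ in (0 : ℝ)..(s + ‖y‖), p τ := by
  have h := radius_mul_weightedMean_zero hp ‖y‖ s
  have hn : 0 < ‖y‖ := norm_pos_iff.2 hy
  change 0 < weightedMean 0 p ‖y‖ s ↔ _
  rw [← mul_pos_iff_of_pos_left hn, h, sub_pos]

/-- Used both for the blow-up time on the axis and for the first radius at which the mean vanishes
at a fixed time. -/
theorem exists_first_zero {p : ℝ → ℝ} (hp : Continuous p) (h0 : 0 < p 0) {r₀ : ℝ} (hr : 0 < r₀)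
    (hpr : p r₀ ≤ 0) : ∃ t₀, 0 < t₀ ∧ t₀ ≤ r₀ ∧ p t₀ = 0 ∧ ∀ s ∈ Ico 0 t₀, 0 < p s := by
  have hK : IsCompact (Icc 0 r₀ ∩ {s | p s ≤ 0}) :=
    isCompact_Icc.inter_right (isClosed_le hp continuous_const)
  obtain ⟨t₀, ⟨⟨ht0, htr⟩, hpt⟩, hmin⟩ := hK.exists_isLeast ⟨r₀, ⟨hr.le, le_rfl⟩, hpr⟩
  have hpos : 0 < t₀ := by
    rcases ht0.eq_or_lt with h | h
    · subst h; exact absurd h0 (not_lt.2 hpt)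
    · exact h
  have hlt : ∀ s ∈ Ico 0 t₀, 0 < p s := by
    intro s hs
    by_contra hc
    exact absurd (hmin ⟨⟨hs.1, hs.2.le.trans htr⟩, not_lt.1 hc⟩) (not_le.2 hs.2)
  refine ⟨t₀, hpos, htr, le_antisymm hpt ?_, hlt⟩
  refine ge_of_tendsto (hp.continuousWithinAt (s := Iio t₀) (x := t₀)) ?_
  filter_upwards [Ioo_mem_nhdsLT hpos] with s hs
  exact (hlt s ⟨hs.1.le, hs.2⟩).le

section Apex

variable {p : ℝ → ℝ} {t₀ : ℝ}

theorem strictMonoOn_primitive (hp : Continuous p) (hlt : ∀ s ∈ Ico 0 t₀, 0 < p s) :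
    StrictMonoOn (fun b => ∫ τ in (0 : ℝ)..b, p τ) (Icc 0 t₀) := by
  refine strictMonoOn_of_deriv_pos (convex_Icc 0 t₀)
    (intervalIntegral.continuous_primitive (fun a b => hp.intervalIntegrable a b) 0).continuousOn ?_
  intro s hs
  rw [interior_Icc] at hs
  rw [hp.deriv_integral]
  exact hlt s ⟨hs.1.le, hs.2⟩

theorem primitive_neg_lt (hp : Continuous p) (hinit : ∀ x : E3, 0 < radialMean 0 p (x, 0)) {r : ℝ}
    (hr : 0 < r) : (∫ τ in (0 : ℝ)..(-r), p τ) < ∫ τ in (0 : ℝ)..r, p τ := by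
  have hn : ‖(EuclideanSpace.single 0 r : E3)‖ = r := by simp [abs_of_pos hr]
  have h := (radialMean_zero_pos_iff hp (y := EuclideanSpace.single 0 r)
    (by rw [← norm_pos_iff, hn]; exact hr) 0).1 (hinit _)
  rwa [hn, zero_sub, zero_add] at h

/-- Below the backward characteristic from the apex the primitive P is compared at s - |y| and s +
|y|. P increases on [0, t₀], and a negative s - |y| is first reflected by P(-r) < P(r), which is
positivity at time 0. -/
theorem radialMean_pos_of_add_lt (hp : Continuous p) (hlt : ∀ s ∈ Ico 0 t₀, 0 < p s)
    (hinit : ∀ x : E3, 0 < radialMean 0 p (x, 0)) {y : E3} {s : ℝ} (hs : 0 ≤ s)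
    (hy : s + ‖y‖ < t₀) : 0 < radialMean 0 p (y, s) := by
  by_cases h0 : y = 0
  · subst h0
    rw [norm_zero, add_zero] at hy
    unfold radialMean
    rw [norm_zero, weightedMean_zero_radius_zero]
    exact mul_pos two_pos (hlt s ⟨hs, hy⟩)
  · have hn : 0 < ‖y‖ := norm_pos_iff.2 h0
    rw [radialMean_zero_pos_iff hp h0]
    have hmono := strictMonoOn_primitive hp hlt
    rcases le_or_gt 0 (s - ‖y‖) with ha | ha
    · exact hmono ⟨ha, by linarith⟩ ⟨by linarith, hy.le⟩ (by linarith)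
    · have h1 := primitive_neg_lt hp hinit (r := ‖y‖ - s) (by linarith)
      rw [neg_sub] at h1
      exact h1.trans_le (hmono.monotoneOn ⟨by linarith, by linarith⟩ ⟨by linarith, hy.le⟩
        (by linarith))

theorem axis_mem_positivityDomain (hp : Continuous p) (hlt : ∀ s ∈ Ico 0 t₀, 0 < p s)
    (hinit : ∀ x : E3, 0 < radialMean 0 p (x, 0)) {t : ℝ} (ht : t ∈ Ico 0 t₀) :
    ((0 : E3), t) ∈ positivityDomain (radialMean 0 p) := by
  intro y s hs hy
  simp only [uIcc_of_le ht.1, sub_zero] at hs hy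
  rw [abs_of_nonneg (by linarith [hs.2])] at hy
  exact radialMean_pos_of_add_lt hp hlt hinit hs.1 (by linarith [ht.2])

/-- Near the apex, positivity along the segment of radii at time t forces positivity on the whole
cone below. So the slice of the domain contains the ball up to the first zero of the mean. -/
theorem exists_mem_positivityDomain_near_apex (hp : Continuous p) (ht₀ : 0 < t₀)
    (hlt : ∀ s ∈ Ico 0 t₀, 0 < p s) (hinit : ∀ x : E3, 0 < radialMean 0 p (x, 0)) :
    ∃ ε, 0 < ε ∧ ε ≤ 1 ∧ ∀ t ∈ Ioo (t₀ - ε) t₀, 0 < t ∧ ∀ x : E3, ‖x‖ < ε →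
      (∀ r ∈ Icc 0 ‖x‖, 0 < weightedMean 0 p r t) →
      (x, t) ∈ positivityDomain (radialMean 0 p) := by
  set P : ℝ → ℝ := fun b => ∫ τ in (0 : ℝ)..b, p τ with hP
  have hPc : Continuous P :=
    intervalIntegral.continuous_primitive (fun a b => hp.intervalIntegrable a b) 0
  have hev : ∀ᶠ q : ℝ × ℝ in 𝓝 (t₀, t₀), P (-q.1) < P q.2 :=
    (isOpen_lt (hPc.comp continuous_fst.neg) (hPc.comp continuous_snd)).mem_nhds
      (primitive_neg_lt hp hinit ht₀)
  obtain ⟨e, he, hball⟩ := Metric.eventually_nhds_iff.1 hev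
  have hmono : StrictMonoOn P (Icc 0 t₀) := strictMonoOn_primitive hp hlt
  -- The bound e/3 keeps the relevant arguments within e of t₀, t₀/3 keeps t - |x| positive, and 1
  -- keeps x in the unit ball.
  refine ⟨min (e / 3) (min (t₀ / 3) 1), by positivity, by simp, ?_⟩
  set ε := min (e / 3) (min (t₀ / 3) 1)
  have hε1 : ε ≤ e / 3 := min_le_left _ _
  have hε2 : ε ≤ t₀ / 3 := (min_le_right _ _).trans (min_le_left _ _)
  rintro t ⟨ht1, ht2⟩
  have htpos : 0 < t := by linarith
  refine ⟨htpos, fun x hx hpos y s hs hy => ?_⟩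
  simp only [uIcc_of_le htpos.le] at hs hy
  rw [abs_of_nonneg (by linarith [hs.2])] at hy
  have hy1 : ‖y‖ ≤ ‖x‖ + (t - s) := by
    have := norm_sub_norm_le y x; linarith
  have hy2 : ‖x‖ ≤ ‖y‖ + (t - s) := by
    have := norm_sub_norm_le x y; rw [norm_sub_rev] at this; linarith
  rcases lt_or_ge (s + ‖y‖) t₀ with hb | hb
  · exact radialMean_pos_of_add_lt hp hlt hinit hs.1 hb
  have hy0 : y ≠ 0 := by
    rw [← norm_pos_iff]; linarith [hs.2]
  rw [radialMean_zero_pos_iff hp hy0]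
  change P _ < P _
  -- The incoming characteristic through (y, s), continued to time t, meets radius s + |y| - t ≤
  -- |x|, where positivity is assumed.
  have hbx : P (t - ‖x‖) < P (s + ‖y‖) := by
    have h1 := hpos (s + ‖y‖ - t) ⟨by linarith, by linarith⟩
    have h2 := radius_mul_weightedMean_zero hp (s + ‖y‖ - t) t
    have h3 : 0 < (s + ‖y‖ - t) * weightedMean 0 p (s + ‖y‖ - t) t :=
      mul_pos (by linarith) h1
    rw [h2, add_sub_cancel, sub_pos] at h3
    exact (hmono.monotoneOn ⟨by linarith, by linarith⟩ ⟨by linarith, by linarith⟩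
      (by linarith)).trans_lt h3
  rcases le_or_gt 0 (s - ‖y‖) with ha | ha
  · exact (hmono.monotoneOn ⟨ha, by linarith [norm_nonneg x]⟩
      ⟨by linarith, by linarith [norm_nonneg x]⟩ (by linarith)).trans_lt hbx
  rcases le_or_gt (‖y‖ - s) (t - ‖x‖) with hc | hc
  · have h1 := primitive_neg_lt hp hinit (r := ‖y‖ - s) (by linarith)
    rw [neg_sub] at h1
    exact (h1.trans_le (hmono.monotoneOn ⟨by linarith, by linarith [norm_nonneg x]⟩
      ⟨by linarith, by linarith [norm_nonneg x]⟩ hc)).trans hbx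
  -- Here both |y| - s and s + |y| are close to t₀, and P(-t₀) < P(t₀) persists by continuity.
  · have h1 := @hball (‖y‖ - s, s + ‖y‖) ?_
    · simpa using h1
    · rw [Prod.dist_eq, max_lt_iff, Real.dist_eq, Real.dist_eq, abs_lt, abs_lt]
      have := hs.1
      refine ⟨⟨?_, ?_⟩, ?_, ?_⟩ <;> simp only <;> linarith

end Apex

/-! ### Lower bounds for the two norms. -/

theorem ofReal_le_normLInfty {D : Set (E3 × ℝ)} (hD : IsOpen D) {u : E3 → ℝ → ℝ}
    (hu : ContinuousOn (fun p : E3 × ℝ => u p.1 p.2) D) {x₀ : E3} {t : ℝ} (h : (x₀, t) ∈ D) :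
    ENNReal.ofReal (u x₀ t) ≤ normLInfty (ballSlice D x₀ t) (fun x => u x t) := by
  refine le_of_forall_lt fun b hb => ?_
  by_contra hc
  rw [not_lt] at hc
  have hbt : b ≠ ⊤ := ne_top_of_lt hb
  have hbu : b.toReal < u x₀ t := (ENNReal.lt_ofReal_iff_toReal_lt hbt).1 hb
  have hslice : ContinuousOn (fun x => u x t) {x | (x, t) ∈ D} :=
    hu.comp (Continuous.prodMk_left t).continuousOn fun _ h => h
  have hO : IsOpen ({x | (x, t) ∈ D} ∩ (fun x => u x t) ⁻¹' Ioi b.toReal) :=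
    hslice.isOpen_inter_preimage (hD.preimage (Continuous.prodMk_left t)) isOpen_Ioi
  set O := Metric.ball x₀ 1 ∩ ({x | (x, t) ∈ D} ∩ (fun x => u x t) ⁻¹' Ioi b.toReal)
  have hO' : IsOpen O := Metric.isOpen_ball.inter hO
  have hsub : O ⊆ ballSlice D x₀ t := fun x hx => ⟨(mem_ball_iff_norm.1 hx.1).le, hx.2.1⟩
  have hvol : 0 < volume.restrict (ballSlice D x₀ t) O := by
    rw [Measure.restrict_apply hO'.measurableSet, inter_eq_left.2 hsub]
    exact hO'.measure_pos volume ⟨x₀, Metric.mem_ball_self one_pos, h, hbu⟩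
  have hae : ∀ᵐ x ∂volume.restrict (ballSlice D x₀ t), ‖u x t‖ₑ ≤ b := by
    filter_upwards [ae_le_eLpNormEssSup (f := fun x => u x t)
      (μ := volume.restrict (ballSlice D x₀ t))] with x hx
    refine hx.trans ?_
    rwa [normLInfty, eLpNorm_exponent_top] at hc
  refine hvol.ne' (measure_mono_null (fun x hx => ?_) (ae_iff.1 hae))
  simp only [mem_ofPred_eq, not_le]
  refine ((ENNReal.lt_ofReal_iff_toReal_lt hbt).2 hx.2.2).trans_le ?_
  rw [Real.enorm_eq_ofReal_abs]
  exact ENNReal.ofReal_le_ofReal (le_abs_self _)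

theorem exists_norm_one_inner_eq_zero {x : E3} (hx : x ≠ 0) :
    ∃ e : E3, ‖e‖ = 1 ∧ inner ℝ x e = 0 := by
  have : Fact (Module.finrank ℝ E3 = 2 + 1) := ⟨by simp⟩
  have h := Submodule.finrank_orthogonal_span_singleton (𝕜 := ℝ) (n := 2) hx
  have hne : (ℝ ∙ x)ᗮ ≠ ⊥ := by
    intro h0
    rw [h0, finrank_bot] at h
    norm_num at h
  obtain ⟨w, hw, hw0⟩ := Submodule.exists_mem_ne_zero_of_ne_bot hne
  refine ⟨‖w‖⁻¹ • w, by rw [norm_smul, norm_inv, norm_norm, inv_mul_cancel₀ (by simpa using hw0)],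
    ?_⟩
  rw [inner_smul_right, Submodule.mem_orthogonal_singleton_iff_inner_right.1 hw, mul_zero]

/-- The angle condition bounds the cross term by |a||b||x||y|, and AM-GM absorbs it into half of the
squares. -/
theorem norm_smul_sub_smul_sq_ge {x y : E3} (h : |inner ℝ x y| ≤ ‖x‖ * ‖y‖ / 2) (a b : ℝ) :
    (a * ‖x‖) ^ 2 / 2 ≤ ‖a • x - b • y‖ ^ 2 := by
  rw [norm_sub_sq_real, norm_smul, norm_smul, inner_smul_left, inner_smul_right, mul_pow, mul_pow,
    Real.norm_eq_abs, Real.norm_eq_abs, mul_pow, sq_abs, sq_abs]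
  simp only [conj_trivial]
  have h1 : a * (b * inner ℝ x y) ≤ |a| * |b| * (‖x‖ * ‖y‖ / 2) := by
    refine (le_abs_self _).trans ?_
    rw [abs_mul, abs_mul, ← mul_assoc]
    gcongr
  have h2 := sq_nonneg (|a| * ‖x‖ - |b| * ‖y‖)
  have h3 := mul_nonneg (sq_nonneg b) (sq_nonneg ‖y‖)
  have e : (|a| * ‖x‖ - |b| * ‖y‖) ^ 2
      = a ^ 2 * ‖x‖ ^ 2 + b ^ 2 * ‖y‖ ^ 2 - 2 * (|a| * |b| * (‖x‖ * ‖y‖)) := by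
    rw [← sq_abs a, ← sq_abs b]; ring
  rw [e] at h2
  linarith

/-- Volume of the unit ball of `ℝ³`. -/
noncomputable def unitBallVolume : ℝ := (volume : Measure E3).real (Metric.ball 0 1)

theorem unitBallVolume_pos : 0 < unitBallVolume :=
  ENNReal.toReal_pos (Metric.measure_ball_pos _ _ one_pos).ne' measure_ball_lt_top.ne

theorem volume_ball_eq_ofReal (x : E3) {r : ℝ} (hr : 0 ≤ r) :
    volume (Metric.ball x r) = ENNReal.ofReal (r ^ 3 * unitBallVolume) := by
  rw [Measure.addHaar_ball _ x hr, ENNReal.ofReal_mul (by positivity), unitBallVolume, Measure.real,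
    ENNReal.ofReal_toReal measure_ball_lt_top.ne]
  simp

/-- The Gagliardo seminorm integral of order `1/2` of a vector field on `S`. -/
noncomputable def gagliardoHalf (S : Set E3) (g : E3 → E3) : ℝ≥0∞ :=
  ∫⁻ x in S, ∫⁻ y in S, ‖g x - g y‖ₑ ^ 2 / ‖x - y‖ₑ ^ 4

/-- Integration over y is restricted to a ball of radius |x|/8 about a point at distance |x|/2 in a
direction orthogonal to x. There y is nearly orthogonal to x, so no cancellation between the
gradients is possible, and |y| < |x| keeps y inside the ball of radius ρ. The constant is 32 · 8³ =
16384. -/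
theorem gagliardo_inner_ge {S : Set E3} {ρ : ℝ} (hS : Metric.ball 0 ρ ⊆ S) {g : E3 → E3}
    {G : ℝ → ℝ} (hg : ∀ x ∈ Metric.ball (0 : E3) ρ, g x = G ‖x‖ • x) {x : E3}
    (hx : x ∈ Metric.ball (0 : E3) ρ) :
    ENNReal.ofReal (unitBallVolume / 16384 * (G ‖x‖ ^ 2 * ‖x‖))
      ≤ ∫⁻ y in S, ‖g x - g y‖ₑ ^ 2 / ‖x - y‖ₑ ^ 4 := by
  rcases eq_or_ne x 0 with rfl | hx0
  · simp
  have hn : 0 < ‖x‖ := norm_pos_iff.2 hx0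
  have hxρ := mem_ball_zero_iff.1 hx
  obtain ⟨e, he1, he2⟩ := exists_norm_one_inner_eq_zero hx0
  set B := Metric.ball ((‖x‖ / 2) • e) (‖x‖ / 8)
  have hcn : ‖(‖x‖ / 2) • e‖ = ‖x‖ / 2 := by
    rw [norm_smul, he1, mul_one, Real.norm_of_nonneg (by positivity)]
  have hB : ∀ y ∈ B, ‖y‖ ≤ 5 / 8 * ‖x‖ ∧ 3 / 8 * ‖x‖ ≤ ‖y‖ := by
    intro y hy
    have hy' := mem_ball_iff_norm.1 hy
    have h1 := norm_sub_norm_le y ((‖x‖ / 2) • e)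
    have h2 := norm_sub_norm_le ((‖x‖ / 2) • e) y
    rw [norm_sub_rev] at h2
    rw [hcn] at h1 h2
    constructor <;> linarith
  have hBρ : B ⊆ Metric.ball 0 ρ := fun y hy =>
    mem_ball_zero_iff.2 (by linarith [(hB y hy).1])
  have hpt : ∀ y ∈ B, ENNReal.ofReal (G ‖x‖ ^ 2 / (32 * ‖x‖ ^ 2))
      ≤ ‖g x - g y‖ₑ ^ 2 / ‖x - y‖ₑ ^ 4 := by
    intro y hy
    obtain ⟨hy1, hy2⟩ := hB y hy
    have hne : 0 < ‖x - y‖ := by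
      have := norm_sub_norm_le x y
      linarith
    have hle : ‖x - y‖ ≤ 2 * ‖x‖ := by
      have := norm_sub_le x y
      linarith
    have hin : |inner ℝ x y| ≤ ‖x‖ * ‖y‖ / 2 := by
      have h1 : inner ℝ x y = inner ℝ x (y - (‖x‖ / 2) • e) := by
        rw [inner_sub_right, inner_smul_right, he2, mul_zero, sub_zero]
      rw [h1]
      have h2 := mem_ball_iff_norm.1 hy
      calc |inner ℝ x (y - (‖x‖ / 2) • e)| ≤ ‖x‖ * ‖y - (‖x‖ / 2) • e‖ := abs_real_inner_le_norm _ _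
        _ ≤ ‖x‖ * (‖y‖ / 2) := by gcongr; linarith
        _ = ‖x‖ * ‖y‖ / 2 := by ring
    have hnum := norm_smul_sub_smul_sq_ge hin (G ‖x‖) (G ‖y‖)
    rw [← hg x hx, ← hg y (hBρ hy)] at hnum
    rw [← ofReal_norm, ← ofReal_norm, ← ENNReal.ofReal_pow (norm_nonneg _),
      ← ENNReal.ofReal_pow (norm_nonneg _), ← ENNReal.ofReal_div_of_pos (by positivity)]
    refine ENNReal.ofReal_le_ofReal ?_
    calc G ‖x‖ ^ 2 / (32 * ‖x‖ ^ 2) = ((G ‖x‖ * ‖x‖) ^ 2 / 2) / (2 * ‖x‖) ^ 4 := by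
          field_simp; ring
      _ ≤ ‖g x - g y‖ ^ 2 / ‖x - y‖ ^ 4 := by gcongr
  calc ENNReal.ofReal (unitBallVolume / 16384 * (G ‖x‖ ^ 2 * ‖x‖))
      = ∫⁻ _ in B, ENNReal.ofReal (G ‖x‖ ^ 2 / (32 * ‖x‖ ^ 2)) := by
        rw [setLIntegral_const, volume_ball_eq_ofReal _ (by positivity),
          ← ENNReal.ofReal_mul (by positivity)]
        congr 1
        field_simp; ring
    _ ≤ ∫⁻ y in B, ‖g x - g y‖ₑ ^ 2 / ‖x - y‖ₑ ^ 4 :=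
        setLIntegral_mono' measurableSet_ball hpt
    _ ≤ ∫⁻ y in S, ‖g x - g y‖ₑ ^ 2 / ‖x - y‖ₑ ^ 4 := lintegral_mono_set (hBρ.trans hS)

/-- The absolute constant in the lower bound for the seminorm. -/
noncomputable def hardyConst : ℝ := unitBallVolume / 16384 * (3 * unitBallVolume)

theorem hardyConst_pos : 0 < hardyConst := by
  have := unitBallVolume_pos
  unfold hardyConst; positivity

/-- The pointwise bound is integrated in polar coordinates; 3 · `unitBallVolume` is the area of the
unit sphere. -/
theorem gagliardoHalf_ge_integral {S : Set E3} {ρ : ℝ} (hS : Metric.ball 0 ρ ⊆ S) {g : E3 → E3}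
    {G : ℝ → ℝ} (hg : ∀ x ∈ Metric.ball (0 : E3) ρ, g x = G ‖x‖ • x) {a b : ℝ} (ha : 0 < a)
    (hab : a < b) (hb : b < ρ) :
    ENNReal.ofReal (hardyConst * ∫ r in a..b, G r ^ 2 * r ^ 3) ≤ gagliardoHalf S g := by
  set h : ℝ → ℝ := (Ioc a b).indicator fun r => G r ^ 2 * r with hh
  have hv := unitBallVolume_pos
  have hI : ∫ x : E3, h ‖x‖ = 3 * unitBallVolume * ∫ r in a..b, G r ^ 2 * r ^ 3 := by
    rw [integral_fun_norm_addHaar volume h, intervalIntegral.integral_of_le hab.le]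
    have h1 : ∀ y, y ^ (Module.finrank ℝ E3 - 1) • h y
        = (Ioc a b).indicator (fun r => G r ^ 2 * r ^ 3) y := by
      intro y
      by_cases hy : y ∈ Ioc a b
      · simp [hh, hy]; ring
      · simp [hh, hy]
    simp only [h1]
    rw [setIntegral_indicator measurableSet_Ioc,
      inter_eq_right.2 (show Ioc a b ⊆ Ioi 0 from fun y hy => ha.trans hy.1)]
    simp [unitBallVolume]
    ring
  calc ENNReal.ofReal (hardyConst * ∫ r in a..b, G r ^ 2 * r ^ 3)
      = ENNReal.ofReal (unitBallVolume / 16384) * ENNReal.ofReal (∫ x : E3, h ‖x‖) := by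
        rw [← ENNReal.ofReal_mul (by positivity), hI, hardyConst]
        congr 1; ring
    _ ≤ ENNReal.ofReal (unitBallVolume / 16384) * ∫⁻ x : E3, ‖h ‖x‖‖ₑ := by
        gcongr
        refine le_trans ?_ (enorm_integral_le_lintegral_enorm _)
        rw [Real.enorm_eq_ofReal_abs]
        exact ENNReal.ofReal_le_ofReal (le_abs_self _)
    _ = ∫⁻ x : E3, ENNReal.ofReal (unitBallVolume / 16384) * ‖h ‖x‖‖ₑ := by
        rw [lintegral_const_mul' _ _ ENNReal.ofReal_ne_top]
    _ ≤ ∫⁻ x : E3, (Metric.ball (0 : E3) ρ).indicator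
          (fun x => ∫⁻ y in S, ‖g x - g y‖ₑ ^ 2 / ‖x - y‖ₑ ^ 4) x := by
        refine lintegral_mono fun x => ?_
        by_cases hx : ‖x‖ ∈ Ioc a b
        · have hxρ : x ∈ Metric.ball (0 : E3) ρ := mem_ball_zero_iff.2 (hx.2.trans_lt hb)
          rw [indicator_of_mem hxρ, hh, indicator_of_mem hx, Real.enorm_of_nonneg (by positivity),
            ← ENNReal.ofReal_mul (by positivity)]
          exact gagliardo_inner_ge hS hg hxρ
        · simp [hh, hx]
    _ = ∫⁻ x in Metric.ball (0 : E3) ρ, ∫⁻ y in S, ‖g x - g y‖ₑ ^ 2 / ‖x - y‖ₑ ^ 4 :=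
        lintegral_indicator measurableSet_ball _
    _ ≤ gagliardoHalf S g := lintegral_mono_set hS

/-- AM-GM in the form r|G| ≤ G² r³ + 1/(4r). Linear rather than squared dependence on the logarithm
suffices, because both terms will be compared with the same L. -/
theorem abs_sub_le_integral_add_log {F G : ℝ → ℝ} {a b : ℝ} (ha : 0 < a) (hab : a < b)
    (hF : ∀ r ∈ Icc a b, HasDerivAt F (r * G r) r) (hG : ContinuousOn G (Icc a b)) :
    |F b - F a| ≤ (∫ r in a..b, G r ^ 2 * r ^ 3) + Real.log (b / a) / 4 := by
  have hu : uIcc a b = Icc a b := uIcc_of_le hab.le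
  have hpos : ∀ r ∈ Icc a b, 0 < r := fun r hr => ha.trans_le hr.1
  have hc1 : ContinuousOn (fun r => r * G r) (Icc a b) := continuousOn_id.mul hG
  have hi2 : IntervalIntegrable (fun r => G r ^ 2 * r ^ 3) volume a b :=
    ContinuousOn.intervalIntegrable (hu ▸ (hG.pow 2).mul (continuousOn_pow 3))
  have hi3 : IntervalIntegrable (fun r : ℝ => r⁻¹ / 4) volume a b :=
    ContinuousOn.intervalIntegrable (hu ▸ (continuousOn_id.inv₀ fun r hr =>
      (hpos r hr).ne').div_const 4)
  rw [← intervalIntegral.integral_eq_sub_of_hasDerivAt (hu ▸ hF)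
    (ContinuousOn.intervalIntegrable (hu ▸ hc1))]
  calc |∫ r in a..b, r * G r| ≤ ∫ r in a..b, |r * G r| :=
        intervalIntegral.abs_integral_le_integral_abs hab.le
    _ ≤ ∫ r in a..b, (G r ^ 2 * r ^ 3 + r⁻¹ / 4) := by
        refine intervalIntegral.integral_mono_on hab.le
          (ContinuousOn.intervalIntegrable (hu ▸ hc1.abs)) (hi2.add hi3) fun r hr => ?_
        have hr0 := hpos r hr
        rw [abs_mul, abs_of_pos hr0, ← sq_abs (G r)]
        have : |G r| ^ 2 * r ^ 3 + r⁻¹ / 4 - r * |G r| = r⁻¹ * (|G r| * r ^ 2 - 1 / 2) ^ 2 := by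
          field_simp; ring
        have h2 : 0 ≤ r⁻¹ * (|G r| * r ^ 2 - 1 / 2) ^ 2 := by positivity
        linarith
    _ = (∫ r in a..b, G r ^ 2 * r ^ 3) + Real.log (b / a) / 4 := by
        rw [intervalIntegral.integral_add hi2 hi3, intervalIntegral.integral_div,
          integral_inv_of_pos ha (ha.trans hab)]

theorem gagliardoHalf_ge {S : Set E3} {ρ : ℝ} (hS : Metric.ball 0 ρ ⊆ S) {g : E3 → E3}
    {F G : ℝ → ℝ} (hg : ∀ x ∈ Metric.ball (0 : E3) ρ, g x = G ‖x‖ • x)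
    (hF : ∀ r ∈ Ioo 0 ρ, HasDerivAt F (r * G r) r) (hG : ContinuousOn G (Ioo 0 ρ))
    {a b : ℝ} (ha : 0 < a) (hab : a < b) (hb : b < ρ) :
    ENNReal.ofReal (hardyConst * (|F b - F a| - Real.log (b / a) / 4)) ≤ gagliardoHalf S g := by
  have hsub : Icc a b ⊆ Ioo 0 ρ := fun r hr => ⟨ha.trans_le hr.1, hr.2.trans_lt hb⟩
  refine le_trans (ENNReal.ofReal_le_ofReal ?_) (gagliardoHalf_ge_integral hS hg ha hab hb)
  have := abs_sub_le_integral_add_log ha hab (fun r hr => hF r (hsub hr)) (hG.mono hsub)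
  have := hardyConst_pos
  gcongr
  linarith

theorem ofReal_le_normHThreeHalves {S : Set E3} {f : E3 → ℝ} {c L : ℝ} (hc : 0 ≤ c) (hL : 0 ≤ L)
    (h : ENNReal.ofReal (c ^ 2 * L) ≤ (∫⁻ x in S, ‖f x‖ₑ ^ 2) ∨
      ENNReal.ofReal (c ^ 2 * L) ≤ gagliardoHalf S (gradient f)) :
    ENNReal.ofReal (c * L ^ (1 / 2 : ℝ)) ≤ normHThreeHalves S f := by
  have h1 : c * L ^ (1 / 2 : ℝ) = (c ^ 2 * L) ^ (1 / 2 : ℝ) := by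
    rw [Real.mul_rpow (sq_nonneg c) hL, ← Real.sqrt_eq_rpow, ← Real.sqrt_eq_rpow, Real.sqrt_sq hc]
  rw [h1, ← ENNReal.ofReal_rpow_of_nonneg (by positivity) (by norm_num)]
  refine ENNReal.rpow_le_rpow ?_ (by norm_num)
  rcases h with h | h
  · exact h.trans (le_self_add.trans le_self_add)
  · exact h.trans le_add_self

theorem hasDerivAt_weightedMean_zero {p : ℝ → ℝ} (hp : ContDiff ℝ ∞ p) (r t : ℝ) :
    HasDerivAt (fun r => weightedMean 0 p r t)
      (r * (1 / 2 * weightedMean 1 (deriv (deriv p)) r t)) r := by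
  have h := (hasFDerivAt_weightedMean 0 (contDiff_infty.1 hp 1) (r, t)).comp_hasDerivAt r
    ((hasDerivAt_id r).prodMk (hasDerivAt_const r t))
  refine h.congr_deriv ?_
  have := integral_weight_mul_id_mul 0 (contDiff_infty.1 (contDiff_infty_deriv hp) 1) r t
  simp only [Nat.cast_zero, zero_add, mul_one] at this
  simp only [this]
  simp

/-- The function `G` for which the spatial gradient of `-log (radialMean 0 p)` is `G(|x|) x`. -/
noncomputable def logGradientFactor (p : ℝ → ℝ) (t r : ℝ) : ℝ :=
  -(1 / 2 * weightedMean 1 (deriv (deriv p)) r t) / weightedMean 0 p r t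

theorem hasDerivAt_neg_log_weightedMean {p : ℝ → ℝ} (hp : ContDiff ℝ ∞ p) {r t : ℝ}
    (h : 0 < weightedMean 0 p r t) :
    HasDerivAt (fun r => -Real.log (weightedMean 0 p r t)) (r * logGradientFactor p t r) r := by
  refine ((hasDerivAt_weightedMean_zero hp r t).log h.ne').neg.congr_deriv ?_
  unfold logGradientFactor
  ring

theorem gradient_neg_log_radialMean {p : ℝ → ℝ} (hp : ContDiff ℝ ∞ p) {x : E3} {t : ℝ}
    (h : 0 < radialMean 0 p (x, t)) :
    gradient (fun x => -Real.log (radialMean 0 p (x, t))) x = logGradientFactor p t ‖x‖ • x := by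
  refine HasGradientAt.gradient ?_
  rw [hasGradientAt_iff_hasFDerivAt]
  have h1 : HasFDerivAt (fun y : E3 => (y, t)) (ContinuousLinearMap.inl ℝ E3 ℝ) x :=
    hasFDerivAt_prodMk_left x t
  have h2 := HasFDerivAt.comp (g := radialMean 0 p) x
    (hasFDerivAt_radialMean 0 (contDiff_infty.1 hp 2) (x, t)) h1
  refine (HasFDerivAt.log (f := fun x => radialMean 0 p (x, t)) h2 h.ne').neg.congr_fderiv ?_
  ext y
  simp [logGradientFactor, radialMean]
  ring

theorem continuous_weightedMean_radius (k : ℕ) {q : ℝ → ℝ} (hq : ContDiff ℝ ∞ q) (t : ℝ) :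
    Continuous fun r => weightedMean k q r t :=
  (continuous_weightedMean k (contDiff_infty.1 hq 1)).comp (Continuous.prodMk_left t)

theorem gagliardoHalf_neg_log_radialMean_ge {p : ℝ → ℝ} (hp : ContDiff ℝ ∞ p) {t ρ : ℝ} {S : Set E3}
    (hS : Metric.ball 0 ρ ⊆ S) (hpos : ∀ r ∈ Ico 0 ρ, 0 < weightedMean 0 p r t) {a b : ℝ}
    (ha : 0 < a) (hab : a < b) (hb : b < ρ) :
    ENNReal.ofReal (hardyConst * (|-Real.log (weightedMean 0 p b t)
        - -Real.log (weightedMean 0 p a t)| - Real.log (b / a) / 4))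
      ≤ gagliardoHalf S (gradient fun x => -Real.log (radialMean 0 p (x, t))) := by
  refine gagliardoHalf_ge (F := fun r => -Real.log (weightedMean 0 p r t))
    (G := logGradientFactor p t) hS (fun x hx => ?_) (fun r hr => ?_) ?_ ha hab hb
  · exact gradient_neg_log_radialMean hp (hpos ‖x‖ ⟨norm_nonneg x, mem_ball_zero_iff.1 hx⟩)
  · exact hasDerivAt_neg_log_weightedMean hp (hpos r ⟨hr.1.le, hr.2⟩)
  · unfold logGradientFactor
    have h2 := contDiff_infty_deriv (contDiff_infty_deriv hp)
    exact ((continuous_const.mul (continuous_weightedMean_radius 1 h2 t)).neg.continuousOn).div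
      (continuous_weightedMean_radius 0 hp t).continuousOn fun r hr => (hpos r ⟨hr.1.le, hr.2⟩).ne'

/-- If the mean vanishes on a sphere, the seminorm of its logarithm inside is infinite. -/
theorem gagliardoHalf_neg_log_eq_top {p : ℝ → ℝ} (hp : ContDiff ℝ ∞ p) {t ρ : ℝ} {S : Set E3}
    (hρ : 0 < ρ) (hS : Metric.ball 0 ρ ⊆ S) (hpos : ∀ r ∈ Ico 0 ρ, 0 < weightedMean 0 p r t)
    (hzero : weightedMean 0 p ρ t = 0) :
    gagliardoHalf S (gradient fun x => -Real.log (radialMean 0 p (x, t))) = ⊤ := by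
  refine ENNReal.eq_top_of_forall_nnreal_le fun N => ?_
  set A := -Real.log (weightedMean 0 p (ρ / 2) t)
  -- The summand 1 absorbs the logarithmic error, since b/(ρ/2) ≤ 2.
  set K := A + 1 + N / hardyConst
  have hlim : ∀ᶠ b in 𝓝[<] ρ, weightedMean 0 p b t < Real.exp (-K) :=
    ((continuous_weightedMean_radius 0 hp t).continuousWithinAt (s := Iio ρ) (x := ρ)).eventually
      (gt_mem_nhds (hzero.trans_lt (Real.exp_pos _)))
  obtain ⟨b, hb, hbρ⟩ := (hlim.and (Ioo_mem_nhdsLT (half_lt_self hρ))).exists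
  have hb0 := hpos b ⟨by linarith [hbρ.1], hbρ.2⟩
  have hlog : K < -Real.log (weightedMean 0 p b t) := by
    have := (Real.log_lt_iff_lt_exp hb0).2 hb
    linarith
  refine le_trans ?_ (gagliardoHalf_neg_log_radialMean_ge hp hS hpos (half_pos hρ) hbρ.1 hbρ.2)
  rw [← ENNReal.ofReal_coe_nnreal]
  refine ENNReal.ofReal_le_ofReal ?_
  have hc := hardyConst_pos
  have h2 : Real.log (b / (ρ / 2)) ≤ 1 := by
    have h3 : b / (ρ / 2) ≤ 2 := by
      rw [div_le_iff₀ (half_pos hρ)]; linarith [hbρ.2]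
    have h4 : 0 < b / (ρ / 2) := div_pos (by linarith [hbρ.1]) (half_pos hρ)
    have := Real.log_le_sub_one_of_pos h4
    linarith
  have h5 : (N : ℝ) / hardyConst ≤ |-Real.log (weightedMean 0 p b t) - A|
      - Real.log (b / (ρ / 2)) / 4 := by
    have := le_abs_self (-Real.log (weightedMean 0 p b t) - A)
    linarith
  have := (div_le_iff₀ hc).1 h5
  linarith

theorem lintegral_sq_ge_of_annulus {S : Set E3} {ε m : ℝ} (hε : 0 < ε) (hm : 0 ≤ m)
    (hS : Metric.ball 0 ε ⊆ S) {f : E3 → ℝ} (hf : ∀ x : E3, ‖x‖ ∈ Ioo (ε / 2) ε → m ≤ f x) :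
    ENNReal.ofReal (m ^ 2 * ((ε / 4) ^ 3 * unitBallVolume)) ≤ ∫⁻ x in S, ‖f x‖ₑ ^ 2 := by
  set z : E3 := EuclideanSpace.single 0 (3 * ε / 4)
  have hz : ‖z‖ = 3 * ε / 4 := by
    simp only [z, PiLp.norm_single]
    exact Real.norm_of_nonneg (by positivity)
  have hB : ∀ x ∈ Metric.ball z (ε / 4), ‖x‖ ∈ Ioo (ε / 2) ε := by
    intro x hx
    have hx' := mem_ball_iff_norm.1 hx
    have h1 := norm_sub_norm_le x z
    have h2 := norm_sub_norm_le z x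
    rw [norm_sub_rev] at h2
    constructor <;> linarith
  calc ENNReal.ofReal (m ^ 2 * ((ε / 4) ^ 3 * unitBallVolume))
      = ∫⁻ _ in Metric.ball z (ε / 4), ENNReal.ofReal (m ^ 2) := by
        rw [setLIntegral_const, volume_ball_eq_ofReal _ (by positivity),
          ENNReal.ofReal_mul (by positivity)]
    _ ≤ ∫⁻ x in Metric.ball z (ε / 4), ‖f x‖ₑ ^ 2 := by
        refine setLIntegral_mono' measurableSet_ball fun x hx => ?_
        have := hf x (hB x hx)
        rw [Real.enorm_of_nonneg (hm.trans this), ← ENNReal.ofReal_pow (hm.trans this)]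
        exact ENNReal.ofReal_le_ofReal (by gcongr)
    _ ≤ ∫⁻ x in S, ‖f x‖ₑ ^ 2 :=
        lintegral_mono_set fun x hx => hS (mem_ball_zero_iff.2 (hB x hx).2)

/-- Logarithmic lower bound for one of the two terms of the `H^{3/2}` norm. -/
theorem lintegral_sq_or_gagliardoHalf_ge {p : ℝ → ℝ} (hp : ContDiff ℝ ∞ p) {t ε δ C L : ℝ}
    {S : Set E3} (hS : Metric.ball 0 ε ⊆ S) (hpos : ∀ r ∈ Ico 0 ε, 0 < weightedMean 0 p r t)
    (hδ : 0 < δ) (hδε : δ < ε / 2) (hε1 : ε ≤ 1) (hLδ : L = -Real.log δ)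
    (hL1 : 8 * C ≤ L) (hL2 : 32 * hardyConst / ((ε / 4) ^ 3 * unitBallVolume) ≤ L)
    (hδF : L - C ≤ -Real.log (weightedMean 0 p δ t)) :
    ENNReal.ofReal (hardyConst / 2 * L)
        ≤ (∫⁻ x in S, ‖-Real.log (radialMean 0 p (x, t))‖ₑ ^ 2) ∨
      ENNReal.ofReal (hardyConst / 2 * L)
        ≤ gagliardoHalf S (gradient fun x => -Real.log (radialMean 0 p (x, t))) := by
  have hc := hardyConst_pos
  have hv := unitBallVolume_pos
  have hε : 0 < ε := by linarith
  have hL0 : 0 < L := lt_of_lt_of_le (by positivity) hL2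
  -- In the second case the value falls from at least L - L/8 to below L/8 while the logarithmic
  -- error is at most L/4, leaving L/2.
  by_cases hcase : ∀ x : E3, ‖x‖ ∈ Ioo (ε / 2) ε → L / 8 ≤ -Real.log (radialMean 0 p (x, t))
  · left
    refine le_trans (ENNReal.ofReal_le_ofReal ?_)
      (lintegral_sq_ge_of_annulus hε (by positivity) hS hcase)
    rw [div_le_iff₀ (by positivity)] at hL2
    calc hardyConst / 2 * L = (32 * hardyConst) * (L / 64) := by ring
      _ ≤ (L * ((ε / 4) ^ 3 * unitBallVolume)) * (L / 64) := by gcongr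
      _ = (L / 8) ^ 2 * ((ε / 4) ^ 3 * unitBallVolume) := by ring
  · right
    push Not at hcase
    obtain ⟨x, hx, hlt⟩ := hcase
    refine le_trans (ENNReal.ofReal_le_ofReal ?_)
      (gagliardoHalf_neg_log_radialMean_ge hp hS hpos hδ (hδε.trans hx.1) hx.2)
    have hlt' : -Real.log (weightedMean 0 p ‖x‖ t) < L / 8 := hlt
    have hxpos : 0 < ‖x‖ := by linarith [hx.1]
    have hlog : Real.log (‖x‖ / δ) ≤ L := by
      rw [Real.log_div hxpos.ne' hδ.ne', hLδ]
      have := Real.log_nonpos hxpos.le (hx.2.le.trans hε1)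
      linarith
    have habs := neg_abs_le (-Real.log (weightedMean 0 p ‖x‖ t) - -Real.log (weightedMean 0 p δ t))
    have : L / 2 ≤ |-Real.log (weightedMean 0 p ‖x‖ t) - -Real.log (weightedMean 0 p δ t)|
        - Real.log (‖x‖ / δ) / 4 := by linarith
    calc hardyConst / 2 * L = hardyConst * (L / 2) := by ring
      _ ≤ _ := by gcongr

/-! ### Blow-up at the apex and time reversal. -/

/-- Blow-up at the apex, for positive times. -/
theorem exists_blowup_pos {p : ℝ → ℝ} (hp : ContDiff ℝ ∞ p)
    (hinit : ∀ x : E3, 0 < radialMean 0 p (x, 0)) {r₀ : ℝ} (hr₀ : 0 < r₀) (hpr : p r₀ ≤ 0) :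
    ∃ t₀, 0 < t₀ ∧ t₀ ≤ r₀ ∧ ((0 : E3), t₀) ∉ positivityDomain (radialMean 0 p) ∧
      (∀ t ∈ Ioo 0 t₀, ((0 : E3), t) ∈ positivityDomain (radialMean 0 p)) ∧
      ∃ C : ℝ, ∀ᶠ t in 𝓝[<] t₀,
        ENNReal.ofReal (C + |Real.log (|t - t₀|)|)
          ≤ normLInfty (ballSlice (positivityDomain (radialMean 0 p)) 0 t)
              (fun x => -Real.log (radialMean 0 p (x, t))) ∧
        ENNReal.ofReal (√(hardyConst / 2) * |Real.log (|t - t₀|)| ^ (1 / 2 : ℝ))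
          ≤ normHThreeHalves (ballSlice (positivityDomain (radialMean 0 p)) 0 t)
              (fun x => -Real.log (radialMean 0 p (x, t))) := by
  have hpc : Continuous p := hp.continuous
  have hV := contDiff_radialMean 0 hp
  have hp0 : 0 < p 0 := by
    have := hinit 0
    unfold radialMean at this
    rw [norm_zero, weightedMean_zero_radius_zero] at this
    linarith
  obtain ⟨t₀, ht₀, htr, hpt, hlt⟩ := exists_first_zero hpc hp0 hr₀ hpr
  have hV0 : radialMean 0 p ((0 : E3), t₀) = 0 := by
    unfold radialMean
    rw [norm_zero, weightedMean_zero_radius_zero, hpt, mul_zero]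
  refine ⟨t₀, ht₀, htr, fun h => (pos_of_mem_positivityDomain h).ne' hV0,
    fun t ht => axis_mem_positivityDomain hpc hlt hinit ⟨ht.1.le, ht.2⟩, ?_⟩
  obtain ⟨ε, hε, hε1, hdom⟩ := exists_mem_positivityDomain_near_apex hpc ht₀ hlt hinit
  obtain ⟨M, hM, hMb⟩ := ((contDiff_infty.1 hV 1).differentiable one_ne_zero
    ((0 : E3), t₀)).isBigO_sub.exists_pos
  obtain ⟨e, he, hball⟩ := Metric.eventually_nhds_iff.1 hMb.bound
  -- The thresholds that L = |log(t₀ - t)| must exceed in the two-case estimate; `M` is the constant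
  -- in the first-order bound for v at the apex.
  set N := max (8 * Real.log M) (32 * hardyConst / ((ε / 4) ^ 3 * unitBallVolume))
  set η := min (min (ε / 2) e) (Real.exp (-N))
  have hη : 0 < η := lt_min (lt_min (half_pos hε) he) (Real.exp_pos _)
  refine ⟨-Real.log M, ?_⟩
  filter_upwards [Ioo_mem_nhdsLT (show t₀ - η < t₀ by linarith)] with t ht
  set δ := t₀ - t with hδdef
  have hδ : 0 < δ := sub_pos.2 ht.2
  have hδη : δ < η := by linarith [ht.1]
  have hδε : δ < ε / 2 := hδη.trans_le ((min_le_left _ _).trans (min_le_left _ _))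
  have hδe : δ < e := hδη.trans_le ((min_le_left _ _).trans (min_le_right _ _))
  have habs : |t - t₀| = δ := by rw [abs_sub_comm, abs_of_pos hδ]
  have hlogabs : |Real.log δ| = -Real.log δ :=
    abs_of_neg (Real.log_neg hδ (by linarith))
  rw [habs, hlogabs]
  set L := -Real.log δ with hL
  have hLN : N ≤ L := by
    have := (Real.log_lt_iff_lt_exp hδ).2 (hδη.trans_le (min_le_right _ _))
    linarith
  have hL0 : 0 ≤ L := hlogabs ▸ abs_nonneg _
  obtain ⟨htpos, hdomt⟩ := hdom t ⟨by linarith, ht.2⟩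
  have haxis := axis_mem_positivityDomain hpc hlt hinit ⟨htpos.le, ht.2⟩
  have hupper : ∀ x : E3, ‖x‖ ≤ δ → 0 < radialMean 0 p (x, t) →
      L - Real.log M ≤ -Real.log (radialMean 0 p (x, t)) := by
    intro x hx hxpos
    have hnorm : ‖(x, t) - ((0 : E3), t₀)‖ ≤ δ := by
      rw [Prod.norm_def, max_le_iff]
      refine ⟨by simpa using hx, ?_⟩
      simp only [Prod.mk_sub_mk, Real.norm_eq_abs, habs, le_refl]
    have h1 := hball (y := (x, t)) (by rw [dist_eq_norm]; exact hnorm.trans_lt hδe)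
    rw [hV0, sub_zero] at h1
    have h2 : radialMean 0 p (x, t) ≤ M * δ :=
      (le_abs_self _).trans (h1.trans (by gcongr))
    have h3 := Real.log_le_log hxpos h2
    rw [Real.log_mul hM.ne' hδ.ne'] at h3
    linarith
  constructor
  · refine le_trans (ENNReal.ofReal_le_ofReal ?_)
      (ofReal_le_normLInfty (isOpen_positivityDomain hV.continuous)
        (u := fun x t => -Real.log (radialMean 0 p (x, t)))
        (contDiffOn_neg_log hV).continuousOn haxis)
    have := hupper 0 (by simpa using hδ.le) (pos_of_mem_positivityDomain haxis)
    linarith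
  · refine ofReal_le_normHThreeHalves (Real.sqrt_nonneg _) hL0 ?_
    rw [Real.sq_sqrt (by have := hardyConst_pos; positivity)]
    have hslice : ∀ ρ ≤ ε, (∀ r ∈ Ico 0 ρ, 0 < weightedMean 0 p r t) →
        Metric.ball 0 ρ ⊆ ballSlice (positivityDomain (radialMean 0 p)) 0 t := by
      intro ρ hρ hpos x hx
      have hx' := mem_ball_zero_iff.1 hx
      exact ⟨by rw [sub_zero]; linarith, hdomt x (by linarith) fun r hr =>
        hpos r ⟨hr.1, hr.2.trans_lt hx'⟩⟩
    -- Either the slice contains a ball of fixed radius, or the mean has a first zero ρ < ε and the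
    -- seminorm inside that sphere is infinite.
    by_cases hcase : ∀ r ∈ Ico 0 ε, 0 < weightedMean 0 p r t
    · refine lintegral_sq_or_gagliardoHalf_ge hp (hslice ε le_rfl hcase) hcase hδ hδε hε1 hL
        ((le_max_left _ _).trans hLN) ((le_max_right _ _).trans hLN) ?_
      have hn : ‖(EuclideanSpace.single 0 δ : E3)‖ = δ := by simp [abs_of_pos hδ]
      have := hupper (EuclideanSpace.single 0 δ) hn.le
      unfold radialMean at this
      simp only [hn] at this
      exact this (hcase δ ⟨hδ.le, by linarith⟩)
    · right
      push Not at hcase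
      obtain ⟨r, hr, hrneg⟩ := hcase
      have h0 : 0 < weightedMean 0 p 0 t := by
        have := pos_of_mem_positivityDomain haxis
        unfold radialMean at this
        simpa only [norm_zero] using this
      have hrpos : 0 < r := by
        rcases hr.1.eq_or_lt with h | h
        · rw [← h] at hrneg; exact absurd h0 (not_lt.2 hrneg)
        · exact h
      obtain ⟨ρ, hρ, hρr, hρ0, hρpos⟩ := exists_first_zero
        (continuous_weightedMean_radius 0 hp t) h0 hrpos hrneg
      rw [gagliardoHalf_neg_log_eq_top hp hρ (hslice ρ (hρr.trans hr.2.le) hρpos) hρpos hρ0]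
      exact le_top

theorem mem_positivityDomain_comp_neg_time {V W : E3 × ℝ → ℝ} (h : ∀ x t, W (x, t) = V (x, -t))
    (x : E3) (t : ℝ) : (x, t) ∈ positivityDomain W ↔ (x, -t) ∈ positivityDomain V := by
  have key : ∀ {V W : E3 × ℝ → ℝ}, (∀ x t, W (x, t) = V (x, -t)) → ∀ (x : E3) (t : ℝ),
      (x, -t) ∈ positivityDomain V → (x, t) ∈ positivityDomain W := by
    intro V W h x t hp y s hs hy
    rw [h]
    refine hp y (-s) ?_ (hy.trans_eq ?_)
    · simp only [mem_uIcc] at hs ⊢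
      rcases hs with hs | hs
      · right; constructor <;> linarith [hs.1, hs.2]
      · left; constructor <;> linarith [hs.1, hs.2]
    · rw [← abs_neg]; congr 1; simp only; ring
  refine ⟨fun hp => key (V := W) (W := V) (fun x t => ?_) x (-t) (by rwa [neg_neg]), key h x t⟩
  rw [h, neg_neg]

theorem radialMean_comp_neg (p : ℝ → ℝ) (x : E3) (t : ℝ) :
    radialMean 0 (fun s => p (-s)) (x, t) = radialMean 0 p (x, -t) :=
  (weightedMean_neg_time 0 p ‖x‖ t).symm

theorem weightedMean_half_add (k : ℕ) {f h : ℝ → ℝ} (hf : Continuous f) (hh : Continuous h)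
    (r t : ℝ) : weightedMean k (fun s => (f s + h s) / 2) r t
      = (weightedMean k f r t + weightedMean k h r t) / 2 := by
  unfold weightedMean
  rw [← intervalIntegral.integral_add ((by fun_prop : Continuous _).intervalIntegrable _ _)
    ((by fun_prop : Continuous _).intervalIntegrable _ _), ← intervalIntegral.integral_div]
  refine intervalIntegral.integral_congr fun σ _ => ?_
  simp only
  ring

/-! ### Profiles with prescribed Cauchy data. -/

/-- The one-dimensional profile whose spherical means solve the linear wave equation with data
`v(0) = α(|x|)`, `v_t(0) = β(|x|)`. -/
noncomputable def waveProfile (α β : ℝ → ℝ) (s : ℝ) : ℝ :=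
  (deriv (fun s => s * α s) s + s * β s) / 2

section Profile

variable {α β : ℝ → ℝ}

theorem contDiff_id_mul (hα : ContDiff ℝ ∞ α) : ContDiff ℝ ∞ fun s => s * α s :=
  contDiff_id.mul hα

theorem contDiff_waveProfile (hα : ContDiff ℝ ∞ α) (hβ : ContDiff ℝ ∞ β) :
    ContDiff ℝ ∞ (waveProfile α β) :=
  ((contDiff_infty_deriv (contDiff_id_mul hα)).add (contDiff_id_mul hβ)).div_const 2

/-- At time 0 the mean only sees the even part of the profile; s β is odd and drops out. For the
time derivative the roles of α and β are exchanged. -/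
theorem radialMean_waveProfile (hα : ContDiff ℝ ∞ α) (hβ : ContDiff ℝ ∞ β)
    (hαe : ∀ s, α (-s) = α s) (hβe : ∀ s, β (-s) = β s) (x : E3) :
    radialMean 0 (waveProfile α β) (x, 0) = α ‖x‖ := by
  change weightedMean 0 (fun s => (deriv (fun s => s * α s) s + s * β s) / 2) ‖x‖ 0 = _
  rw [weightedMean_half_add 0 (contDiff_infty_deriv (contDiff_id_mul hα)).continuous
    (contDiff_id_mul hβ).continuous, weightedMean_deriv_id_mul (contDiff_infty.1 hα 1) hαe,
    weightedMean_zero_of_odd (fun s => by rw [hβe]; ring)]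
  ring

theorem dirDeriv_time_radialMean_waveProfile (hα : ContDiff ℝ ∞ α) (hβ : ContDiff ℝ ∞ β)
    (hαe : ∀ s, α (-s) = α s) (hβe : ∀ s, β (-s) = β s) (x : E3) :
    dirDeriv timeDir (radialMean 0 (waveProfile α β)) (x, 0) = β ‖x‖ := by
  have h1 := contDiff_infty_deriv (contDiff_id_mul hα)
  have h2 := contDiff_id_mul hβ
  rw [dirDeriv_time_radialMean 0 (contDiff_infty.1 (contDiff_waveProfile hα hβ) 2)]
  have hd : deriv (waveProfile α β) = fun s =>
      (deriv (deriv fun s => s * α s) s + deriv (fun s => s * β s) s) / 2 := by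
    funext s
    exact (((h1.differentiable (by simp) s).hasDerivAt.add
      (h2.differentiable (by simp) s).hasDerivAt).div_const 2).deriv
  rw [hd]
  change weightedMean 0 _ ‖x‖ 0 = _
  rw [weightedMean_half_add 0 (contDiff_infty_deriv h1).continuous
    (contDiff_infty_deriv h2).continuous, weightedMean_deriv_id_mul (contDiff_infty.1 hβ 1) hβe,
    weightedMean_zero_of_odd (deriv_odd_of_even (deriv_even_of_odd fun s => by rw [hαe]; ring))]
  ring

theorem waveProfile_apply (hα : ContDiff ℝ ∞ α) (s : ℝ) :
    waveProfile α β s = (α s + s * deriv α s + s * β s) / 2 := by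
  have h : HasDerivAt (fun s => s * α s) (1 * α s + s * deriv α s) s :=
    (hasDerivAt_id' s).fun_mul (hα.differentiable (by simp) s).hasDerivAt
  rw [waveProfile, h.deriv, one_mul]

end Profile

/-- The apex blow-up in either time direction. -/
theorem exists_blowup {p : ℝ → ℝ} (hp : ContDiff ℝ ∞ p)
    (hinit : ∀ x : E3, 0 < radialMean 0 p (x, 0)) {r₀ : ℝ} (hr₀ : 0 < r₀)
    (hpr : p r₀ ≤ 0 ∨ p (-r₀) ≤ 0) :
    ∃ t₀ : ℝ, t₀ ≠ 0 ∧ |t₀| ≤ r₀ ∧ ((0 : E3), t₀) ∉ positivityDomain (radialMean 0 p) ∧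
      (∀ t ∈ uIoo 0 t₀, ((0 : E3), t) ∈ positivityDomain (radialMean 0 p)) ∧
      ∃ C : ℝ, ∀ᶠ t in 𝓝[uIoo 0 t₀] t₀,
        ENNReal.ofReal (C + |Real.log (|t - t₀|)|)
          ≤ normLInfty (ballSlice (positivityDomain (radialMean 0 p)) 0 t)
              (fun x => -Real.log (radialMean 0 p (x, t))) ∧
        ENNReal.ofReal (√(hardyConst / 2) * |Real.log (|t - t₀|)| ^ (1 / 2 : ℝ))
          ≤ normHThreeHalves (ballSlice (positivityDomain (radialMean 0 p)) 0 t)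
              (fun x => -Real.log (radialMean 0 p (x, t))) := by
  rcases hpr with hpr | hpr
  · obtain ⟨t₀, h1, h2, h3, h4, C, hC⟩ := exists_blowup_pos hp hinit hr₀ hpr
    refine ⟨t₀, h1.ne', by rwa [abs_of_pos h1], h3, ?_, C, ?_⟩
    · rwa [uIoo_of_le h1.le]
    · rw [uIoo_of_le h1.le]
      exact hC.filter_mono (nhdsWithin_mono _ fun t ht => ht.2)
  · obtain ⟨t₀, h1, h2, h3, h4, C, hC⟩ := exists_blowup_pos (p := fun s => p (-s))
      (hp.comp contDiff_neg) (fun x => by rw [radialMean_comp_neg, neg_zero]; exact hinit x)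
      hr₀ hpr
    have hdom := mem_positivityDomain_comp_neg_time (radialMean_comp_neg p)
    have hneg : -t₀ ≤ 0 := by linarith
    refine ⟨-t₀, by simpa using h1.ne', by rwa [abs_neg, abs_of_pos h1], by rwa [← hdom], ?_, C, ?_⟩
    · rw [uIoo_of_ge hneg]
      intro t ht
      have := (hdom 0 (-t)).1 (h4 (-t) ⟨by linarith [ht.2], by linarith [ht.1]⟩)
      rwa [neg_neg] at this
    · rw [uIoo_of_ge hneg]
      have htend : Tendsto Neg.neg (𝓝[>] (-t₀)) (𝓝[<] t₀) := tendsto_neg_nhdsGT_neg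
      have hC' := (htend.eventually hC).filter_mono
        (nhdsWithin_mono _ fun t ht => ht.1 : 𝓝[Ioo (-t₀) 0] (-t₀) ≤ 𝓝[>] (-t₀))
      filter_upwards [hC'] with t ht
      have hslice : ballSlice (positivityDomain (radialMean 0 fun s => p (-s))) 0 (-t)
          = ballSlice (positivityDomain (radialMean 0 p)) 0 t := by
        ext x
        simp only [ballSlice, mem_ofPred_eq]
        rw [hdom, neg_neg]
      have habs : |-t - t₀| = |t - -t₀| := by rw [← abs_neg]; congr 1; ring
      simp only [radialMean_comp_neg, neg_neg] at ht
      rwa [hslice, habs] at ht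

/-! ### Radial data and conclusion. -/

theorem contDiff_radialProfile {f : E3 → ℝ} (hf : ContDiff ℝ ∞ f) :
    ContDiff ℝ ∞ (radialProfile f) := by
  have h : ContDiff ℝ ∞ fun r : ℝ => (EuclideanSpace.single 0 r : E3) := by
    have : (fun r : ℝ => (EuclideanSpace.single 0 r : E3))
        = fun r : ℝ => r • (EuclideanSpace.single 0 1 : E3) := by
      funext r
      ext i
      simp
    rw [this]
    exact contDiff_id.smul contDiff_const
  exact hf.comp h

theorem IsRadial.radialProfile_neg {f : E3 → ℝ} (hf : IsRadial f) (r : ℝ) :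
    radialProfile f (-r) = radialProfile f r :=
  hf _ _ (by simp)

theorem IsRadial.radialProfile_norm {f : E3 → ℝ} (hf : IsRadial f) (x : E3) :
    radialProfile f ‖x‖ = f x :=
  hf _ _ (by simp)

theorem mainTheorem8 :
    ∃ c : ℝ, 0 < c ∧
      ∀ (u₀ u₁ : E3 → ℝ), ContDiff ℝ ∞ u₀ → ContDiff ℝ ∞ u₁ → IsRadial u₀ → IsRadial u₁ →
      ∀ r₀ : ℝ, 0 < r₀ →
        1 / r₀ ≤ deriv (radialProfile u₀) r₀ + |radialProfile u₁ r₀| →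
        ∃ (D : Set (E3 × ℝ)) (u : E3 → ℝ → ℝ),
          IsMaximalSolution u₀ u₁ D u ∧
          ContDiffOn ℝ ∞ (fun p : E3 × ℝ => u p.1 p.2) D ∧
          ∃ (t₀ : ℝ) (x₀ : E3),
            t₀ ≠ 0 ∧ |t₀| ≤ r₀ ∧
            (x₀, t₀) ∉ D ∧
            (∀ t ∈ uIoo 0 t₀, (x₀, t) ∈ D) ∧
            ∃ C : ℝ, ∀ᶠ t in 𝓝[uIoo 0 t₀] t₀,
              ENNReal.ofReal (C + |Real.log (|t - t₀|)|)
                  ≤ normLInfty (ballSlice D x₀ t) (fun x => u x t) ∧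
              ENNReal.ofReal (c * |Real.log (|t - t₀|)| ^ (1 / 2 : ℝ))
                  ≤ normHThreeHalves (ballSlice D x₀ t) (fun x => u x t) := by
  refine ⟨√(hardyConst / 2), Real.sqrt_pos.2 (half_pos hardyConst_pos), ?_⟩
  intro u₀ u₁ hu₀ hu₁ hr₀ hr₁ r₀ hr₀pos hcond
  set g := radialProfile u₀
  set k := radialProfile u₁
  have hg : ContDiff ℝ ∞ g := contDiff_radialProfile hu₀
  have hk : ContDiff ℝ ∞ k := contDiff_radialProfile hu₁
  set α : ℝ → ℝ := fun s => Real.exp (-g s) with hα_def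
  set β : ℝ → ℝ := fun s => -k s * Real.exp (-g s) with hβ_def
  have hα : ContDiff ℝ ∞ α := hg.neg.exp
  have hβ : ContDiff ℝ ∞ β := hk.neg.mul hg.neg.exp
  have hge : ∀ s, g (-s) = g s := hr₀.radialProfile_neg
  have hke : ∀ s, k (-s) = k s := hr₁.radialProfile_neg
  have hαe : ∀ s, α (-s) = α s := fun s => by simp only [hα_def, hge]
  have hβe : ∀ s, β (-s) = β s := fun s => by simp only [hβ_def, hge, hke]
  have hp := contDiff_waveProfile hα hβ
  have h0 : ∀ x : E3, radialMean 0 (waveProfile α β) (x, 0) = Real.exp (-u₀ x) := fun x => by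
    rw [radialMean_waveProfile hα hβ hαe hβe, ← hr₀.radialProfile_norm x]
  have h1 : ∀ x : E3, dirDeriv timeDir (radialMean 0 (waveProfile α β)) (x, 0)
      = -u₁ x * Real.exp (-u₀ x) := fun x => by
    rw [dirDeriv_time_radialMean_waveProfile hα hβ hαe hβe, ← hr₀.radialProfile_norm x,
      ← hr₁.radialProfile_norm x]
  have hαd : ∀ s, deriv α s = -deriv g s * Real.exp (-g s) := fun s => by
    have := ((hg.differentiable (by simp) s).hasDerivAt.fun_neg.exp).deriv
    rw [this]; ring
  -- The sign of u₁(r₀) selects the time direction: at -r₀ the term s g' is unchanged, because g' is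
  -- odd, while s k changes sign.
  have hsign : waveProfile α β r₀ ≤ 0 ∨ waveProfile α β (-r₀) ≤ 0 := by
    have hval : ∀ s, waveProfile α β s
        = Real.exp (-g s) / 2 * (1 - (s * deriv g s + s * k s)) := fun s => by
      rw [waveProfile_apply hα, hαd]; ring
    rw [div_le_iff₀ hr₀pos] at hcond
    have he := Real.exp_pos (-g r₀)
    rcases le_total 0 (k r₀) with h | h
    · left
      rw [abs_of_nonneg h] at hcond
      rw [hval]
      exact mul_nonpos_of_nonneg_of_nonpos (by positivity) (by linarith)
    · right
      rw [abs_of_nonpos h] at hcond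
      rw [hval, hge, hke, deriv_odd_of_even hge]
      exact mul_nonpos_of_nonneg_of_nonpos (by positivity) (by linarith)
  obtain ⟨t₀, ht₀, htr, hnot, haxis, C, hC⟩ := exists_blowup hp
    (fun x => by rw [h0]; exact Real.exp_pos _) hr₀pos hsign
  exact ⟨positivityDomain (radialMean 0 (waveProfile α β)),
    fun x t => -Real.log (radialMean 0 (waveProfile α β) (x, t)),
    isMaximalSolution_neg_log (contDiff_radialMean 0 hp) (waveOp_radialMean_zero hp) h0 h1,
    contDiffOn_neg_log (contDiff_radialMean 0 hp), t₀, 0, ht₀, htr, hnot, haxis, C, hC⟩
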